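/- **Setting.** There are $n$ agents with valuations $v=(v_1,\dots,v_n)\in[0,\infty)^n$ and $k$ identical units. A (direct, randomized) money-burning mechanism maps each bid profile $v$ to allocation probabilities $x_i(v)\in[0,1]$ with $\sum_i x_i(v)\le k$ and expected burnt payments $p_i(v)\ge 0$; its expected residual surplus on $v$ is $\sum_i (v_i x_i(v)-p_i(v))$. It is *prior-free* if it is truthful in expectation in dominant strategies and individually rational on every profile. **Benchmark.** Let $F$ be a distribution on $[0,\infty)$ with a density $f$ that is positive exactly on an interval. Put $\vartheta(z)=\frac{1-F(z)}{f(z)}$, $H(q)=\int_0^q\vartheta(F^{-1}(r))\,dr$, let $G$ be the largest convex function bounded above by $H$, let $g$ be the derivative of $G$, extended by right-continuity (and at $q=1$ by its limit from the left), and let $\bar\vartheta(z)=g(F(z))$ be the ironed virtual valuation for utility. The mechanism $\mathrm{Opt}_F$ chooses, uniformly at random, one of the sets $S$ of at most $k$ agents that maximize $\sum_{i\in S}\bar\vartheta(v_i)$; with $x_i(v)$ the resulting probability that agent $i$ is served, the expected payments are $p_i(v)=v_ix_i(v)-\int_0^{v_i}x_i(z,v_{-i})\,dz$. The benchmark is $$\mathcal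 G(v)=\sup_F \mathrm{Opt}_F(v),$$ where $\mathrm{Opt}_F(v)$ is the expected residual surplus of $\mathrm{Opt}_F$ on $v$. For $\beta>0$, a mechanism *$\beta$-approximates* $\mathcal G$ if its expected residual surplus on every profile $v$ is at least $\mathcal G(v)/\beta$. **Proposition.** Consider two agents and one unit ($n=2$, $k=1$). If a prior-free money-burning mechanism $\beta$-approximates $\mathcal G$, then $\beta\ge 4/3$. Moreover, for two agents and one unit: (a) if the valuations are i.i.d. standard exponential, then the maximum expected residual surplus over all Bayesian incentive compatible, ex interim individually rational money-burning mechanisms is attained and equals $1$; (b) for every profile with $v_1\ge v_2\ge 0$, $\mathcal G(v)=\max\{\tfrac{v_1+v_2}{2},\,v_1-\tfrac{v_2}{2}\}$ (and symmetrically for $v_2\ge v_1$); (c) if the valuations are i.i.d. standard exponential, then $\mathbb E[\mathcal G(v)]=4/3$. -/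

import Mathlib

open MeasureTheory ProbabilityTheory

noncomputable section

namespace MoneyBurning

/-! ### Money-burning mechanisms for `n` agents and `k` identical units -/

/-- A valuation (or bid) profile is a vector of nonnegative reals. -/
def IsProfile {n : ℕ} (v : Fin n → ℝ) : Prop := ∀ i, 0 ≤ v i

/-- A direct, possibly randomized, money-burning mechanism for `n` agents and `k` units.
`alloc v i` is the probability (over the coins of the mechanism) that agent `i` is served on the
bid profile `v`, and `pay v i` is the expected amount that agent `i` burns.  At most `k` agents are
served, and there are no positive transfers to the agents. -/
structure Mechanism (n k : ℕ) where
  alloc : (Fin n → ℝ) → Fin n → ℝ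
  pay : (Fin n → ℝ) → Fin n → ℝ
  measurable_alloc : ∀ i, Measurable fun v => alloc v i
  measurable_pay : ∀ i, Measurable fun v => pay v i
  alloc_nonneg : ∀ v i, 0 ≤ alloc v i
  alloc_le_one : ∀ v i, alloc v i ≤ 1
  sum_alloc_le : ∀ v, ∑ i, alloc v i ≤ k
  pay_nonneg : ∀ v i, 0 ≤ pay v i

namespace Mechanism

variable {n k : ℕ} (M : Mechanism n k)

/-- Expected residual surplus `∑ i, (v i * x i - p i)` at the profile `v`. -/
def residual (v : Fin n → ℝ) : ℝ := ∑ i, (v i * M.alloc v i - M.pay v i)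

/-- Dominant strategy incentive compatibility for risk-neutral agents
(truthfulness in expectation over the coins of the mechanism). -/
def IsTruthful : Prop :=
  ∀ v, IsProfile v → ∀ i, ∀ b : ℝ, 0 ≤ b →
    v i * M.alloc (Function.update v i b) i - M.pay (Function.update v i b) i
      ≤ v i * M.alloc v i - M.pay v i

/-- Individual rationality on every profile (in expectation over the coins). -/
def IsIR : Prop :=
  ∀ v, IsProfile v → ∀ i, 0 ≤ v i * M.alloc v i - M.pay v i

/-- Prior-free mechanisms: truthful and individually rational on every valuation profile. -/
def IsPriorFree : Prop := M.IsTruthful ∧ M.IsIR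

/-- Probability that agent `i` is served when bidding `b` while the other bids are
distributed according to `μ` (the `i`-th coordinate of the sample is overwritten by `b`). -/
def interimAlloc (μ : Measure (Fin n → ℝ)) (i : Fin n) (b : ℝ) : ℝ :=
  ∫ v, M.alloc (Function.update v i b) i ∂μ

/-- Expected payment of agent `i` when bidding `b`, the other bids being distributed
according to `μ`. -/
def interimPay (μ : Measure (Fin n → ℝ)) (i : Fin n) (b : ℝ) : ℝ :=
  ∫ v, M.pay (Function.update v i b) i ∂μ

/-- Bayesian incentive compatibility together with ex interim individual rationality, for the
product prior `μ`.  The first clause says that the interim payments are finite. -/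
def IsBayesian (μ : Measure (Fin n → ℝ)) : Prop :=
  (∀ i, ∀ b : ℝ, 0 ≤ b → Integrable (fun v => M.pay (Function.update v i b) i) μ) ∧
  (∀ i, ∀ t b : ℝ, 0 ≤ t → 0 ≤ b →
    t * M.interimAlloc μ i b - M.interimPay μ i b
      ≤ t * M.interimAlloc μ i t - M.interimPay μ i t) ∧
  (∀ i, ∀ t : ℝ, 0 ≤ t → 0 ≤ t * M.interimAlloc μ i t - M.interimPay μ i t)

end Mechanism

/-! ### Valuation distributions and ironed virtual valuations for utility -/

/-- A distribution on `[0, ∞)` given by a density that is positive exactly on an interval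
(bounded or not). -/
structure ValueDist where
  density : ℝ → ℝ
  measurable_density : Measurable density
  density_nonneg : ∀ z, 0 ≤ density z
  density_of_neg : ∀ z, z < 0 → density z = 0
  lintegral_density : ∫⁻ z, ENNReal.ofReal (density z) = 1
  ordConnected_support : (Function.support density).OrdConnected

namespace ValueDist

variable (D : ValueDist)

/-- The cumulative distribution function `F`. -/
def cdf (z : ℝ) : ℝ := ∫ x in Set.Iic z, D.density x

/-- The inverse `F⁻¹` of the distribution function. -/
def quantile (q : ℝ) : ℝ := sInf {z : ℝ | q ≤ D.cdf z}

/-- The virtual valuation for utility `(1 - F) / f`. -/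
def virtual (z : ℝ) : ℝ := (1 - D.cdf z) / D.density z

/-- `H(q) = ∫₀^q ϑ(F⁻¹(r)) dr`. -/
def cumVirtual (q : ℝ) : ℝ := ∫ r in (0 : ℝ)..q, D.virtual (D.quantile r)

/-- The largest convex function bounded above by `H`.  The interval `[0, 1)` is used since `H(1)`,
the mean of the distribution, may be infinite; if it is finite, then `H` is continuous on `[0, 1]`
and the hulls over `[0, 1)` and over `[0, 1]` agree on `[0, 1)`. -/
def hull (q : ℝ) : ℝ :=
  sSup {y : ℝ | ∃ φ : ℝ → ℝ, ConvexOn ℝ (Set.Ico 0 1) φ ∧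
    (∀ r ∈ Set.Ico (0 : ℝ) 1, φ r ≤ D.cumVirtual r) ∧ y = φ q}

/-- The derivative of the convex hull, extended by right-continuity, that is, its right derivative.
At `q = 1` there is no right derivative, and the value is the limit from the left, which
is the supremum since the derivative of a convex function is monotone. -/
def hullDeriv (q : ℝ) : EReal :=
  if q < 1 then ((derivWithin D.hull (Set.Ioi q) q : ℝ) : EReal)
  else ⨆ r ∈ Set.Ico (0 : ℝ) 1, ((derivWithin D.hull (Set.Ioi r) r : ℝ) : EReal)

/-- The ironed virtual valuation for utility. -/
def ironed (z : ℝ) : EReal := D.hullDeriv (D.cdf z)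

/-! ### The symmetric optimal mechanism of a distribution, and the benchmark -/

open Classical in
/-- The feasible allocations (sets of at most `k` served agents) that maximize the ironed virtual
surplus at `v`. -/
def optAllocs (n k : ℕ) (v : Fin n → ℝ) : Finset (Finset (Fin n)) :=
  Finset.univ.filter fun S => S.card ≤ k ∧
    ∀ T : Finset (Fin n), T.card ≤ k → ∑ i ∈ T, D.ironed (v i) ≤ ∑ i ∈ S, D.ironed (v i)

/-- The probability that agent `i` is served if one of the maximizing allocations is chosen
uniformly at random. -/
def optAlloc (n k : ℕ) (v : Fin n → ℝ) (i : Fin n) : ℝ :=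
  (((D.optAllocs n k v).filter fun S => i ∈ S).card : ℝ) / ((D.optAllocs n k v).card : ℝ)

/-- The payment identity: `pᵢ(v) = vᵢ xᵢ(v) - ∫₀^{vᵢ} xᵢ(z, v₋ᵢ) dz`. -/
def optPay (n k : ℕ) (v : Fin n → ℝ) (i : Fin n) : ℝ :=
  v i * D.optAlloc n k v i - ∫ z in (0 : ℝ)..(v i), D.optAlloc n k (Function.update v i z) i

/-- Expected residual surplus, on the profile `v`, of the symmetric optimal mechanism for `D`. -/
def optResidual (n k : ℕ) (v : Fin n → ℝ) : ℝ :=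
  ∑ i, (v i * D.optAlloc n k v i - D.optPay n k v i)

end ValueDist

/-- The benchmark `𝒢(v)`: the supremum over all i.i.d. distributions of the residual surplus on `v`
of the symmetric optimal mechanism.  (For a profile `v` the set is bounded by `∑ i, v i`.) -/
def benchmark (n k : ℕ) (v : Fin n → ℝ) : ℝ := ⨆ D : ValueDist, D.optResidual n k v

/-- The mechanism `M` `β`-approximates the benchmark. -/
def Mechanism.Approximates {n k : ℕ} (M : Mechanism n k) (β : ℝ) : Prop :=
  0 < β ∧ ∀ v, IsProfile v → benchmark n k v / β ≤ M.residual v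

/-- The law of two independent standard exponential valuations. -/
def expPrior : Measure (Fin 2 → ℝ) := Measure.pi fun _ => expMeasure 1

end MoneyBurning

end

/-!
For two agents and one unit, the payment identity turns the residual surplus of `Opt_F` into the sum
of the areas under the two allocation curves. Since the ironed virtual valuation is monotone and
nonnegative, only the comparison of its values at `v₁ ≥ v₂` matters: a tie leaves at most
`(v₁ + v₂) / 2`, and if it separates the agents at most `v₁ - v₂ / 2` remains. Distributions whose
hazard rate drops from `1` to `1 / 2` at a point `a` have a nondecreasing virtual valuation, so that
ironing does nothing. Taking `a > v₁` produces the tie, and letting `a` decrease to `v₂` separates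
the agents with the winner served half of the time below `a`.

The lower bound compares means under i.i.d. exponential valuations of rate `r`. There the survival
function is the density divided by `r`, so by the envelope bound the expected utility of an agent is
at most her probability of being served divided by `r`. Hence no Bayesian incentive compatible
mechanism beats a lottery, which for two agents, one unit and `r = 1` earns `1`, whereas the
benchmark has mean `4 / 3`.
-/

namespace MoneyBurning

open Filter Set Topology

section Convexity

variable {f : ℝ → ℝ} {a b : ℝ}

lemma intervalIntegrable_of_monotoneOn_Ioo (hf : MonotoneOn f (Ioo a b))
    (hbdd : BddBelow (f '' Ioo a b)) {x y : ℝ} (hx : x ∈ Ico a b) (hy : y ∈ Ico a b) :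
    IntervalIntegrable f volume x y := by
  wlog hxy : x ≤ y generalizing x y
  · exact (this hy hx (le_of_not_ge hxy)).symm
  rcases hxy.eq_or_lt with rfl | hlt
  · exact .refl
  obtain ⟨m, hm⟩ := hbdd
  have hsub : Ioc x y ⊆ Ioo a b := fun t ht => ⟨hx.1.trans_lt ht.1, ht.2.trans_lt hy.2⟩
  have hmeas : AEMeasurable f (volume.restrict (Ioc x y)) :=
    aemeasurable_restrict_of_monotoneOn measurableSet_Ioc (hf.mono hsub)
  rw [intervalIntegrable_iff_integrableOn_Ioc_of_le hxy]
  refine .of_bound measure_Ioc_lt_top hmeas.aestronglyMeasurable (max |m| |f y|) ?_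
  filter_upwards [ae_restrict_mem measurableSet_Ioc] with t ht
  exact abs_le_max_abs_abs (hm (mem_image_of_mem f (hsub ht)))
    (hf (hsub ht) (hsub ⟨hlt, le_rfl⟩) ht.2)

lemma convexOn_intervalIntegral_of_monotoneOn_Ioo (hf : MonotoneOn f (Ioo a b))
    (hbdd : BddBelow (f '' Ioo a b)) : ConvexOn ℝ (Ico a b) fun x => ∫ t in a..x, f t := by
  refine convexOn_of_slope_mono_adjacent (convex_Ico a b) fun {x y z} hx hz hxy hyz => ?_
  have hyI : y ∈ Ioo a b := ⟨hx.1.trans_lt hxy, hyz.trans hz.2⟩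
  have hy : y ∈ Ico a b := Ioo_subset_Ico_self hyI
  have hint {s t : ℝ} (hs : s ∈ Ico a b) (ht : t ∈ Ico a b) : IntervalIntegrable f volume s t :=
    intervalIntegrable_of_monotoneOn_Ioo hf hbdd hs ht
  have ha : a ∈ Ico a b := ⟨le_rfl, hyI.1.trans hyI.2⟩
  rw [intervalIntegral.integral_interval_sub_left (hint ha hy) (hint ha hx),
    intervalIntegral.integral_interval_sub_left (hint ha hz) (hint ha hy)]
  have hleft : ∫ t in x..y, f t ≤ (y - x) * f y := by
    simpa using intervalIntegral.integral_mono_on_of_le_Ioo hxy.le (hint hx hy)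
      intervalIntegrable_const fun t ht =>
        hf ⟨hx.1.trans_lt ht.1, ht.2.trans hyI.2⟩ hyI ht.2.le
  have hright : (z - y) * f y ≤ ∫ t in y..z, f t := by
    simpa using intervalIntegral.integral_mono_on_of_le_Ioo hyz.le intervalIntegrable_const
      (hint hy hz) fun t ht => hf hyI ⟨hyI.1.trans ht.1, ht.2.trans hz.2⟩ ht.1.le
  calc (∫ t in x..y, f t) / (y - x) ≤ f y := (div_le_iff₀' (sub_pos.2 hxy)).2 hleft
    _ ≤ (∫ t in y..z, f t) / (z - y) := (le_div_iff₀' (sub_pos.2 hyz)).2 hright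

end Convexity

namespace ValueDist

variable (D : ValueDist)

lemma integrable_density : Integrable D.density := by
  refine ⟨D.measurable_density.aestronglyMeasurable, ?_⟩
  rw [hasFiniteIntegral_iff_ofReal (.of_forall D.density_nonneg), D.lintegral_density]
  exact ENNReal.one_lt_top

lemma integral_density : ∫ z, D.density z = 1 := by
  rw [integral_eq_lintegral_of_nonneg_ae (.of_forall D.density_nonneg)
    D.measurable_density.aestronglyMeasurable, D.lintegral_density, ENNReal.toReal_one]

lemma cdf_nonneg (z : ℝ) : 0 ≤ D.cdf z :=
  integral_nonneg D.density_nonneg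

lemma one_sub_cdf (z : ℝ) : 1 - D.cdf z = ∫ x in Ioi z, D.density x := by
  rw [← D.integral_density, ← integral_add_compl measurableSet_Iic D.integrable_density,
    compl_Iic, cdf, add_sub_cancel_left]

lemma cdf_le_one (z : ℝ) : D.cdf z ≤ 1 :=
  sub_nonneg.1 <| (D.one_sub_cdf z).symm ▸ integral_nonneg D.density_nonneg

lemma cdf_sub_cdf (y z : ℝ) : D.cdf z - D.cdf y = ∫ x in y..z, D.density x :=
  intervalIntegral.integral_Iic_sub_Iic D.integrable_density.integrableOn
    D.integrable_density.integrableOn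

lemma monotone_cdf : Monotone D.cdf := fun y z hyz => by
  rw [← sub_nonneg, D.cdf_sub_cdf]
  exact intervalIntegral.integral_nonneg hyz fun x _ => D.density_nonneg x

lemma continuous_cdf : Continuous D.cdf := by
  have hcdf : D.cdf = fun z => D.cdf 0 + ∫ x in (0 : ℝ)..z, D.density x := by
    ext z
    rw [← D.cdf_sub_cdf, add_sub_cancel]
  rw [hcdf]
  exact continuous_const.add (intervalIntegral.continuous_primitive
    (fun _ _ => D.integrable_density.intervalIntegrable) 0)

lemma cdf_of_nonpos {z : ℝ} (hz : z ≤ 0) : D.cdf z = 0 := by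
  rw [cdf, integral_Iic_eq_integral_Iio]
  exact setIntegral_eq_zero_of_forall_eq_zero fun x hx => D.density_of_neg x (hx.trans_le hz)

lemma tendsto_cdf_atTop : Tendsto D.cdf atTop (𝓝 1) :=
  D.integral_density ▸ (aecover_Iic tendsto_id).integral_tendsto_of_countably_generated
    D.integrable_density

section Quantile

variable {r z : ℝ}

lemma quantile_le_iff (hr : r ∈ Ioo 0 1) : D.quantile r ≤ z ↔ r ≤ D.cdf z := by
  have hbdd : BddBelow {z | r ≤ D.cdf z} :=
    ⟨0, fun y hy => le_of_not_gt fun h => (hr.1.trans_le hy).ne' (D.cdf_of_nonpos h.le)⟩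
  have hne : {z | r ≤ D.cdf z}.Nonempty :=
    (D.tendsto_cdf_atTop.eventually (Ici_mem_nhds hr.2)).exists
  have hclosed : IsClosed {z | r ≤ D.cdf z} := isClosed_le continuous_const D.continuous_cdf
  exact ⟨fun h => (hclosed.csInf_mem hne hbdd).trans (D.monotone_cdf h), csInf_le hbdd⟩

lemma cdf_quantile (hr : r ∈ Ioo 0 1) : D.cdf (D.quantile r) = r := by
  refine le_antisymm ?_ ((D.quantile_le_iff hr).1 le_rfl)
  refine le_of_tendsto (D.continuous_cdf.continuousWithinAt (s := Iio (D.quantile r))) ?_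
  filter_upwards [self_mem_nhdsWithin] with z hz
  exact le_of_not_ge fun h => hz.not_ge ((D.quantile_le_iff hr).2 h)

lemma monotoneOn_quantile : MonotoneOn D.quantile (Ioo 0 1) := fun _ hr _ hs hrs =>
  (D.quantile_le_iff hr).2 (hrs.trans (D.cdf_quantile hs).ge)

lemma quantile_mem_support (hr : r ∈ Ioo 0 1) : D.quantile r ∈ Function.support D.density := by
  obtain ⟨x, hxmem, hx⟩ : ∃ x ∈ Iic (D.quantile r), D.density x ≠ 0 := by
    by_contra! h
    exact hr.1.ne' ((D.cdf_quantile hr).symm.trans (setIntegral_eq_zero_of_forall_eq_zero h))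
  obtain ⟨y, hymem, hy⟩ : ∃ y ∈ Ioi (D.quantile r), D.density y ≠ 0 := by
    by_contra! h
    have := D.one_sub_cdf (D.quantile r)
    rw [setIntegral_eq_zero_of_forall_eq_zero h, D.cdf_quantile hr] at this
    exact hr.2.ne' (sub_eq_zero.1 this)
  exact D.ordConnected_support.out hx hy ⟨hxmem, (mem_Ioi.1 hymem).le⟩

lemma tendsto_quantile (hz : ∀ y, z < y → D.cdf z < D.cdf y) :
    Tendsto D.quantile (𝓝[>] D.cdf z) (𝓝[>] z) := by
  have hIoo : ∀ y, z < y → ∀ᶠ r in 𝓝[>] D.cdf z, r ∈ Ioo 0 1 ∧ r ∈ Ioc (D.cdf z) (D.cdf y) := by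
    intro y hy
    filter_upwards [Ioo_mem_nhdsGT (hz y hy)] with r hr
    exact ⟨⟨(D.cdf_nonneg z).trans_lt hr.1, hr.2.trans_le (D.cdf_le_one y)⟩, hr.1, hr.2.le⟩
  have hgt : ∀ᶠ r in 𝓝[>] D.cdf z, z < D.quantile r := by
    filter_upwards [hIoo (z + 1) (lt_add_one z)] with r ⟨hr, hmem⟩
    exact lt_of_not_ge fun h => hmem.1.not_ge ((D.quantile_le_iff hr).1 h)
  refine tendsto_nhdsWithin_iff.2 ⟨tendsto_order.2 ⟨fun x hx => ?_, fun x hx => ?_⟩, hgt⟩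
  · exact hgt.mono fun r => hx.trans
  · obtain ⟨y, hzy, hyx⟩ := exists_between hx
    filter_upwards [hIoo y hzy] with r ⟨hr, hmem⟩
    exact ((D.quantile_le_iff hr).2 hmem.2).trans_lt hyx

end Quantile

lemma virtual_nonneg (z : ℝ) : 0 ≤ D.virtual z :=
  div_nonneg (sub_nonneg.2 (D.cdf_le_one z)) (D.density_nonneg z)

lemma cumVirtual_nonneg {r : ℝ} (hr : 0 ≤ r) : 0 ≤ D.cumVirtual r :=
  intervalIntegral.integral_nonneg hr fun _ _ => D.virtual_nonneg _

section Hull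

variable {q r : ℝ}

lemma le_hull {φ : ℝ → ℝ} (hφ : ConvexOn ℝ (Ico 0 1) φ)
    (h : ∀ r ∈ Ico (0 : ℝ) 1, φ r ≤ D.cumVirtual r) (hq : q ∈ Ico 0 1) : φ q ≤ D.hull q :=
  le_csSup ⟨D.cumVirtual q, by rintro _ ⟨ψ, -, hψ, rfl⟩; exact hψ q hq⟩ ⟨φ, hφ, h, rfl⟩

lemma hull_le {y : ℝ} (hy : ∀ φ : ℝ → ℝ, ConvexOn ℝ (Ico 0 1) φ →
    (∀ r ∈ Ico (0 : ℝ) 1, φ r ≤ D.cumVirtual r) → φ q ≤ y) : D.hull q ≤ y := by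
  refine csSup_le ⟨_, fun _ => 0, convexOn_const 0 (convex_Ico 0 1),
    fun r hr => D.cumVirtual_nonneg hr.1, rfl⟩ ?_
  rintro _ ⟨φ, hφ, h, rfl⟩
  exact hy φ hφ h

lemma hull_nonneg (hq : q ∈ Ico 0 1) : 0 ≤ D.hull q :=
  D.le_hull (convexOn_const 0 (convex_Ico 0 1)) (fun _ hr => D.cumVirtual_nonneg hr.1) hq

lemma hull_zero : D.hull 0 = 0 := by
  refine le_antisymm (D.hull_le fun φ _ h => ?_) (D.hull_nonneg (by simp))
  simpa [cumVirtual] using h 0 (by simp)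

lemma convexOn_hull : ConvexOn ℝ (Ico 0 1) D.hull := by
  refine ⟨convex_Ico 0 1, fun x hx y hy a b ha hb hab => D.hull_le fun φ hφ h => ?_⟩
  calc φ (a • x + b • y) ≤ a * φ x + b * φ y := hφ.2 hx hy ha hb hab
    _ ≤ a * D.hull x + b * D.hull y := by gcongr <;> exact D.le_hull hφ h ‹_›

/-- The right derivative of the convex hull of `H`, the function written `g` in the theory of
ironing, on `[0, 1)`. -/
noncomputable def hullRightDeriv (q : ℝ) : ℝ := derivWithin D.hull (Ioi q) q

lemma slope_hull_le_hullRightDeriv (hr : 0 ≤ r) (hrq : r < q) (hq : q < 1) :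
    slope D.hull r q ≤ D.hullRightDeriv q := by
  have hint : q ∈ interior (Ico (0 : ℝ) 1) := by
    rw [interior_Ico]
    exact ⟨hr.trans_lt hrq, hq⟩
  exact (D.convexOn_hull.slope_le_leftDeriv_of_mem_interior ⟨hr, hrq.trans hq⟩ hint hrq).trans
    (D.convexOn_hull.leftDeriv_le_rightDeriv_of_mem_interior hint)

lemma monotoneOn_hull : MonotoneOn D.hull (Ico 0 1) := by
  intro r hr q hq hrq
  rcases hr.1.eq_or_lt with rfl | hr0
  · exact D.hull_zero.le.trans (D.hull_nonneg hq)
  · exact D.convexOn_hull.le_right_of_left_le'' (by simp) hq hr0 hrq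
      (D.hull_zero.le.trans (D.hull_nonneg hr))

lemma hullRightDeriv_nonneg (hq : q ∈ Ico 0 1) : 0 ≤ D.hullRightDeriv q := by
  rw [hullRightDeriv, ← derivWithin_inter (Iio_mem_nhds hq.2), Ioi_inter_Iio]
  exact (D.monotoneOn_hull.mono fun r hr => ⟨hq.1.trans hr.1.le, hr.2⟩).derivWithin_nonneg

lemma monotoneOn_hullRightDeriv : MonotoneOn D.hullRightDeriv (Ico 0 1) := by
  intro q hq r hr hqr
  rcases hqr.eq_or_lt with rfl | hlt
  · rfl
  by_cases hd : DifferentiableWithinAt ℝ D.hull (Ioi q) q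
  · exact (D.convexOn_hull.rightDeriv_le_slope hq hr hlt hd).trans
      (D.slope_hull_le_hullRightDeriv hq.1 hlt hr.2)
  · exact (derivWithin_zero_of_not_differentiableWithinAt hd).le.trans (D.hullRightDeriv_nonneg hr)

lemma hullDeriv_of_lt (hq : q < 1) : D.hullDeriv q = (D.hullRightDeriv q : EReal) :=
  if_pos hq

lemma monotoneOn_hullDeriv : MonotoneOn D.hullDeriv (Ici 0) := by
  intro q hq r hr hqr
  rcases lt_or_ge r 1 with hr1 | hr1
  · rw [D.hullDeriv_of_lt hr1, D.hullDeriv_of_lt (hqr.trans_lt hr1), EReal.coe_le_coe_iff]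
    exact D.monotoneOn_hullRightDeriv ⟨hq, hqr.trans_lt hr1⟩ ⟨hr, hr1⟩ hqr
  rcases lt_or_ge q 1 with hq1 | hq1
  · rw [D.hullDeriv_of_lt hq1, hullDeriv, if_neg hr1.not_gt]
    exact le_iSup₂ (f := fun (r : ℝ) (_ : r ∈ Ico (0 : ℝ) 1) => (D.hullRightDeriv r : EReal))
      q ⟨hq, hq1⟩
  · rw [hullDeriv, hullDeriv, if_neg hq1.not_gt, if_neg hr1.not_gt]

end Hull

lemma monotone_ironed : Monotone D.ironed := fun y _ h =>
  D.monotoneOn_hullDeriv (D.cdf_nonneg y) (D.cdf_nonneg _) (D.monotone_cdf h)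

lemma ironed_nonneg (z : ℝ) : 0 ≤ D.ironed z := by
  refine le_trans ?_ (D.monotoneOn_hullDeriv self_mem_Ici (D.cdf_nonneg z) (D.cdf_nonneg z))
  rw [D.hullDeriv_of_lt one_pos, EReal.coe_nonneg]
  exact D.hullRightDeriv_nonneg (by simp)

section Regular

variable {D}

lemma bddBelow_virtual_quantile :
    BddBelow ((fun r => D.virtual (D.quantile r)) '' Ioo 0 1) :=
  ⟨0, by rintro _ ⟨r, -, rfl⟩; exact D.virtual_nonneg _⟩

variable (hD : MonotoneOn D.virtual (Function.support D.density))
include hD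

lemma monotoneOn_virtual_quantile :
    MonotoneOn (fun r => D.virtual (D.quantile r)) (Ioo 0 1) := fun _ hr _ hs hrs =>
  hD (D.quantile_mem_support hr) (D.quantile_mem_support hs) (D.monotoneOn_quantile hr hs hrs)

lemma hull_eq_cumVirtual {q : ℝ} (hq : q ∈ Ico 0 1) : D.hull q = D.cumVirtual q :=
  le_antisymm (D.hull_le fun _ _ hφ => hφ q hq) <|
    D.le_hull (convexOn_intervalIntegral_of_monotoneOn_Ioo (monotoneOn_virtual_quantile hD)
      bddBelow_virtual_quantile) (fun _ _ => le_rfl) hq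

lemma hasDerivWithinAt_cumVirtual {q c : ℝ} (hq : q ∈ Ico 0 1)
    (hc : Tendsto (fun r => D.virtual (D.quantile r)) (𝓝[>] q) (𝓝 c)) :
    HasDerivWithinAt D.cumVirtual c (Ici q) q := by
  have hmono := monotoneOn_virtual_quantile hD
  have hsub : Ioo q 1 ⊆ Ioo 0 1 := Ioo_subset_Ioo_left hq.1
  refine intervalIntegral.integral_hasDerivWithinAt_of_tendsto_ae_right
    (intervalIntegrable_of_monotoneOn_Ioo hmono bddBelow_virtual_quantile (by simp) hq)
    ⟨Ioo q 1, Ioo_mem_nhdsGT hq.2, ?_⟩ (hc.mono_left inf_le_left)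
  exact (aemeasurable_restrict_of_monotoneOn measurableSet_Ioo
    (hmono.mono hsub)).aestronglyMeasurable

lemma ironed_eq_of_tendsto_virtual {z c : ℝ} (hz : ∀ y, z < y → D.cdf z < D.cdf y)
    (hc : Tendsto D.virtual (𝓝[>] z) (𝓝 c)) : D.ironed z = c := by
  have hq : D.cdf z ∈ Ico 0 1 :=
    ⟨D.cdf_nonneg z, (hz (z + 1) (lt_add_one z)).trans_le (D.cdf_le_one _)⟩
  have hderiv := hasDerivWithinAt_cumVirtual hD hq (hc.comp (D.tendsto_quantile hz))
  have hcongr : D.hull =ᶠ[𝓝[>] D.cdf z] D.cumVirtual := by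
    filter_upwards [Ioo_mem_nhdsGT hq.2] with r hr
    exact hull_eq_cumVirtual hD ⟨hq.1.trans hr.1.le, hr.2⟩
  rw [ironed, D.hullDeriv_of_lt hq.2, hullRightDeriv,
    hcongr.derivWithin_eq (hull_eq_cumVirtual hD hq),
    (hderiv.mono Ioi_subset_Ici_self).derivWithin (uniqueDiffWithinAt_Ioi _)]

end Regular

end ValueDist

lemma sum_fin_two_of_ne {α : Type*} [AddCommMonoid α] {i j : Fin 2} (hij : i ≠ j)
    (f : Fin 2 → α) : ∑ l, f l = f i + f j := by
  have huniv : Finset.univ = {i, j} :=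
    (by decide : ∀ i j : Fin 2, i ≠ j → Finset.univ = {i, j}) i j hij
  rw [huniv, Finset.sum_pair hij]

namespace ValueDist

variable (D : ValueDist) {n : ℕ} {v w : Fin n → ℝ} {i j : Fin n}

lemma optAlloc_nonneg (k : ℕ) (v : Fin n → ℝ) (i : Fin n) : 0 ≤ D.optAlloc n k v i :=
  div_nonneg (Nat.cast_nonneg _) (Nat.cast_nonneg _)

lemma optAlloc_le_one (k : ℕ) (v : Fin n → ℝ) (i : Fin n) : D.optAlloc n k v i ≤ 1 :=
  div_le_one_of_le₀ (by exact_mod_cast Finset.card_filter_le _ _) (Nat.cast_nonneg _)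

lemma mem_optAllocs_one {S : Finset (Fin n)} : S ∈ D.optAllocs n 1 v ↔
    S.card ≤ 1 ∧ ∀ j, D.ironed (v j) ≤ ∑ i ∈ S, D.ironed (v i) := by
  simp only [optAllocs, Finset.mem_filter, Finset.mem_univ, true_and]
  refine and_congr_right fun _ => ⟨fun h j => by simpa using h {j} (by simp), fun h T hT => ?_⟩
  rcases Nat.le_one_iff_eq_zero_or_eq_one.1 hT with h0 | h1
  · rw [Finset.card_eq_zero.1 h0, Finset.sum_empty]
    exact Finset.sum_nonneg fun _ _ => D.ironed_nonneg _
  · obtain ⟨j, rfl⟩ := Finset.card_eq_one.1 h1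
    simpa using h j

lemma empty_mem_optAllocs_one : ∅ ∈ D.optAllocs n 1 v ↔ ∀ j, D.ironed (v j) ≤ 0 := by
  simp [mem_optAllocs_one]

lemma singleton_mem_optAllocs_one :
    {i} ∈ D.optAllocs n 1 v ↔ ∀ j, D.ironed (v j) ≤ D.ironed (v i) := by
  simp [mem_optAllocs_one]

lemma eq_singleton_of_mem_optAllocs_one {S : Finset (Fin n)} (hS : S ∈ D.optAllocs n 1 v)
    (hi : i ∈ S) : S = {i} :=
  (Finset.eq_singleton_or_nontrivial hi).resolve_right fun h =>
    (Finset.one_lt_card_iff_nontrivial.2 h).not_ge (D.mem_optAllocs_one.1 hS).1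

lemma optAlloc_one_of_notMem (h : {i} ∉ D.optAllocs n 1 v) : D.optAlloc n 1 v i = 0 := by
  have : (D.optAllocs n 1 v).filter (i ∈ ·) = ∅ := Finset.filter_eq_empty_iff.2 fun S hS hi =>
    h (D.eq_singleton_of_mem_optAllocs_one hS hi ▸ hS)
  simp [optAlloc, this]

lemma optAlloc_one_of_mem (h : {i} ∈ D.optAllocs n 1 v) :
    D.optAlloc n 1 v i = ((D.optAllocs n 1 v).card : ℝ)⁻¹ := by
  have : (D.optAllocs n 1 v).filter (i ∈ ·) = {{i}} := by
    ext S
    rw [Finset.mem_filter, Finset.mem_singleton]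
    exact ⟨fun hS => D.eq_singleton_of_mem_optAllocs_one hS.1 hS.2, by rintro rfl; simpa using h⟩
  simp [optAlloc, this]

lemma optAlloc_one_eq_zero (h : D.ironed (v i) < D.ironed (v j)) : D.optAlloc n 1 v i = 0 :=
  D.optAlloc_one_of_notMem fun hi => h.not_ge (D.singleton_mem_optAllocs_one.1 hi j)

lemma optAlloc_one_le_half (hij : i ≠ j) (h : D.ironed (v i) ≤ D.ironed (v j)) :
    D.optAlloc n 1 v i ≤ 1 / 2 := by
  by_cases hi : {i} ∈ D.optAllocs n 1 v
  · have hj : {j} ∈ D.optAllocs n 1 v := D.singleton_mem_optAllocs_one.2 fun l =>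
      (D.singleton_mem_optAllocs_one.1 hi l).trans h
    have htwo : 1 < (D.optAllocs n 1 v).card :=
      Finset.one_lt_card.2 ⟨{i}, hi, {j}, hj, by simpa using hij⟩
    rw [D.optAlloc_one_of_mem hi, one_div]
    exact inv_anti₀ two_pos (by exact_mod_cast htwo)
  · rw [D.optAlloc_one_of_notMem hi]
    norm_num

lemma optAlloc_one_eq_inv_card (hpos : 0 < D.ironed (v i))
    (hmax : ∀ j, D.ironed (v j) ≤ D.ironed (v i)) :
    D.optAlloc n 1 v i = (Finset.card {j | D.ironed (v j) = D.ironed (v i)} : ℝ)⁻¹ := by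
  have hopt : D.optAllocs n 1 v = Finset.map ⟨singleton, Finset.singleton_injective⟩
      {j | D.ironed (v j) = D.ironed (v i)} := by
    ext S
    simp only [Finset.mem_map, Finset.mem_filter, Finset.mem_univ, true_and,
      Function.Embedding.coeFn_mk]
    constructor
    · intro hS
      obtain rfl | ⟨j, hj⟩ := S.eq_empty_or_nonempty
      · exact absurd (D.empty_mem_optAllocs_one.1 hS i) hpos.not_ge
      · obtain rfl := D.eq_singleton_of_mem_optAllocs_one hS hj
        exact ⟨j, (hmax j).antisymm (D.singleton_mem_optAllocs_one.1 hS i), rfl⟩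
    · rintro ⟨j, hj, rfl⟩
      exact D.singleton_mem_optAllocs_one.2 fun l => (hmax l).trans hj.ge
  rw [D.optAlloc_one_of_mem (D.singleton_mem_optAllocs_one.2 hmax), hopt, Finset.card_map]

lemma optAlloc_one_eq_one (hpos : 0 < D.ironed (v i))
    (h : ∀ j, j ≠ i → D.ironed (v j) < D.ironed (v i)) : D.optAlloc n 1 v i = 1 := by
  have hmax : ∀ j, D.ironed (v j) ≤ D.ironed (v i) := fun j =>
    (eq_or_ne j i).elim (fun hj => hj ▸ le_rfl) fun hj => (h j hj).le
  have htop : ({j | D.ironed (v j) = D.ironed (v i)} : Finset (Fin n)) = {i} := by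
    ext j
    simpa using ⟨fun hj => by_contra fun hne => (h j hne).ne hj, by rintro rfl; rfl⟩
  rw [D.optAlloc_one_eq_inv_card hpos hmax, htop, Finset.card_singleton, Nat.cast_one, inv_one]

lemma optAlloc_one_eq_inv_of_forall_eq (hpos : 0 < D.ironed (v i))
    (h : ∀ j, D.ironed (v j) = D.ironed (v i)) : D.optAlloc n 1 v i = (n : ℝ)⁻¹ := by
  rw [D.optAlloc_one_eq_inv_card hpos fun j => (h j).le, Finset.filter_true_of_mem fun j _ => h j,
    Finset.card_univ, Fintype.card_fin]

lemma monotone_optAlloc_one_update (v : Fin n → ℝ) (i : Fin n) :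
    Monotone fun z => D.optAlloc n 1 (Function.update v i z) i := by
  intro y z hyz
  have hle : ∀ j, D.ironed (Function.update v i y j) ≤ D.ironed (Function.update v i z j) :=
    fun j => D.monotone_ironed (Function.update_mono hyz j)
  dsimp only
  by_cases hy : {i} ∈ D.optAllocs n 1 (Function.update v i y)
  · have hz : {i} ∈ D.optAllocs n 1 (Function.update v i z) := by
      refine D.singleton_mem_optAllocs_one.2 fun j => ?_
      rcases eq_or_ne j i with rfl | hj
      · rfl
      · simpa [hj] using (D.singleton_mem_optAllocs_one.1 hy j).trans (hle i)
    have hsub : D.optAllocs n 1 (Function.update v i z) ⊆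
        D.optAllocs n 1 (Function.update v i y) := by
      intro S hS
      by_cases hi : i ∈ S
      · rwa [D.eq_singleton_of_mem_optAllocs_one hS hi]
      · rw [D.mem_optAllocs_one] at hS ⊢
        have hsum : ∑ j ∈ S, D.ironed (Function.update v i z j) =
            ∑ j ∈ S, D.ironed (Function.update v i y j) :=
          Finset.sum_congr rfl fun j hj => by simp [ne_of_mem_of_not_mem hj hi]
        exact ⟨hS.1, fun j => (hle j).trans ((hS.2 j).trans hsum.le)⟩
    rw [D.optAlloc_one_of_mem hy, D.optAlloc_one_of_mem hz]
    exact inv_anti₀ (by exact_mod_cast Finset.card_pos.2 ⟨_, hz⟩)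
      (by exact_mod_cast Finset.card_le_card hsub)
  · rw [D.optAlloc_one_of_notMem hy]
    exact D.optAlloc_nonneg _ _ _

lemma intervalIntegrable_optAlloc_one_update (v : Fin n → ℝ) (i : Fin n) (a b : ℝ) :
    IntervalIntegrable (fun z => D.optAlloc n 1 (Function.update v i z) i) volume a b :=
  (D.monotone_optAlloc_one_update v i).intervalIntegrable

lemma intervalIntegral_optAlloc_one_update_le (v : Fin n → ℝ) (i : Fin n) {a b : ℝ} (hab : a ≤ b) :
    ∫ z in a..b, D.optAlloc n 1 (Function.update v i z) i ≤
      (b - a) * D.optAlloc n 1 (Function.update v i b) i := by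
  simpa using intervalIntegral.integral_mono_on hab
    (D.intervalIntegrable_optAlloc_one_update v i a b) intervalIntegrable_const
    fun z hz => D.monotone_optAlloc_one_update v i hz.2

lemma optResidual_eq_sum_integral (k : ℕ) (v : Fin n → ℝ) : D.optResidual n k v =
    ∑ i, ∫ z in (0 : ℝ)..(v i), D.optAlloc n k (Function.update v i z) i := by
  simp [optResidual, optPay]

lemma optResidual_nonneg (k : ℕ) (hv : IsProfile v) : 0 ≤ D.optResidual n k v := by
  rw [optResidual_eq_sum_integral]
  exact Finset.sum_nonneg fun i _ => intervalIntegral.integral_nonneg (hv i) fun _ _ =>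
    D.optAlloc_nonneg _ _ _

section TwoAgents

variable {v : Fin 2 → ℝ} {i j : Fin 2}

lemma optResidual_two_eq (k : ℕ) (hij : i ≠ j) (v : Fin 2 → ℝ) : D.optResidual 2 k v =
    (∫ z in (0 : ℝ)..(v i), D.optAlloc 2 k (Function.update v i z) i) +
      ∫ z in (0 : ℝ)..(v j), D.optAlloc 2 k (Function.update v j z) j := by
  rw [optResidual_eq_sum_integral, sum_fin_two_of_ne hij]

lemma optResidual_two_one_le_of_ironed_eq (hv : IsProfile v) (hij : i ≠ j)
    (h : D.ironed (v i) = D.ironed (v j)) : D.optResidual 2 1 v ≤ (v i + v j) / 2 := by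
  have half {i j : Fin 2} (hij : i ≠ j) (h : D.ironed (v i) = D.ironed (v j)) :
      ∫ z in (0 : ℝ)..(v i), D.optAlloc 2 1 (Function.update v i z) i ≤ v i / 2 := by
    have hle := D.intervalIntegral_optAlloc_one_update_le v i (hv i)
    rw [Function.update_eq_self, sub_zero] at hle
    linarith [mul_le_mul_of_nonneg_left (D.optAlloc_one_le_half hij h.le) (hv i)]
  rw [D.optResidual_two_eq 1 hij]
  linarith [half hij h, half hij.symm h.symm]

lemma optResidual_two_one_le_of_ironed_lt (hv : IsProfile v) (hij : i ≠ j)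
    (h : D.ironed (v j) < D.ironed (v i)) : D.optResidual 2 1 v ≤ v i - v j / 2 := by
  have hle : v j ≤ v i := (D.monotone_ironed.reflect_lt h).le
  have hwinner_low : ∫ z in (0 : ℝ)..(v j), D.optAlloc 2 1 (Function.update v i z) i ≤ v j / 2 := by
    have hhalf : D.optAlloc 2 1 (Function.update v i (v j)) i ≤ 1 / 2 :=
      D.optAlloc_one_le_half hij (by simp [hij.symm])
    linarith [D.intervalIntegral_optAlloc_one_update_le v i (hv j),
      mul_le_mul_of_nonneg_left hhalf (hv j)]
  have hwinner_high :
      ∫ z in (v j)..(v i), D.optAlloc 2 1 (Function.update v i z) i ≤ v i - v j := by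
    refine (D.intervalIntegral_optAlloc_one_update_le v i hle).trans ?_
    exact mul_le_of_le_one_right (sub_nonneg.2 hle) (D.optAlloc_le_one _ _ _)
  have hloser : ∫ z in (0 : ℝ)..(v j), D.optAlloc 2 1 (Function.update v j z) j ≤ 0 := by
    refine (D.intervalIntegral_optAlloc_one_update_le v j (hv j)).trans ?_
    rw [Function.update_eq_self, D.optAlloc_one_eq_zero h, mul_zero]
  rw [D.optResidual_two_eq 1 hij, ← intervalIntegral.integral_add_adjacent_intervals
    (D.intervalIntegrable_optAlloc_one_update v i 0 (v j))
    (D.intervalIntegrable_optAlloc_one_update v i (v j) (v i))]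
  linarith

lemma optResidual_two_one_le (hv : IsProfile v) (hij : i ≠ j) (h : v j ≤ v i) :
    D.optResidual 2 1 v ≤ max ((v i + v j) / 2) (v i - v j / 2) := by
  rcases (D.monotone_ironed h).lt_or_eq with hlt | heq
  · exact le_max_of_le_right (D.optResidual_two_one_le_of_ironed_lt hv hij hlt)
  · exact le_max_of_le_left (D.optResidual_two_one_le_of_ironed_eq hv hij heq.symm)

end TwoAgents

end ValueDist

section TwoRate

variable {a z : ℝ}

/-- The survival function `exp (-∫₀ᶻ h)` of the hazard rate `h` that equals `1` on `(0, a)` and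
`1 / 2` on `[a, ∞)`; only its values at `z ≥ 0` matter. -/
noncomputable def twoRateSurvival (a z : ℝ) : ℝ := Real.exp (-min z ((a + z) / 2))

/-- The density of the distribution on `[0, ∞)` whose hazard rate is `1` on `(0, a)` and `1 / 2` on
`[a, ∞)`. -/
noncomputable def twoRateDensity (a z : ℝ) : ℝ :=
  if z ≤ 0 then 0 else (if z < a then 1 else 1 / 2) * twoRateSurvival a z

lemma twoRateDensity_of_nonpos (hz : z ≤ 0) : twoRateDensity a z = 0 := if_pos hz

lemma twoRateDensity_of_lt (hz : 0 < z) (hza : z < a) :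
    twoRateDensity a z = twoRateSurvival a z := by
  rw [twoRateDensity, if_neg hz.not_ge, if_pos hza, one_mul]

lemma twoRateDensity_of_ge (hz : 0 < z) (haz : a ≤ z) :
    twoRateDensity a z = 1 / 2 * twoRateSurvival a z := by
  rw [twoRateDensity, if_neg hz.not_ge, if_neg haz.not_gt]

lemma twoRateSurvival_pos : 0 < twoRateSurvival a z := Real.exp_pos _

lemma strictAnti_twoRateSurvival (a : ℝ) : StrictAnti (twoRateSurvival a) := fun y z hyz =>
  Real.exp_lt_exp.2 <| neg_lt_neg <| min_lt_min hyz (by linarith)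

lemma twoRateDensity_pos (hz : 0 < z) : 0 < twoRateDensity a z := by
  rcases lt_or_ge z a with hza | haz
  · exact (twoRateDensity_of_lt hz hza).symm ▸ twoRateSurvival_pos
  · exact (twoRateDensity_of_ge hz haz).symm ▸ mul_pos one_half_pos twoRateSurvival_pos

lemma twoRateSurvival_zero (ha : 0 ≤ a) : twoRateSurvival a 0 = 1 := by
  simpa [twoRateSurvival] using div_nonneg ha zero_le_two

lemma twoRateDensity_nonneg (a z : ℝ) : 0 ≤ twoRateDensity a z :=
  (le_or_gt z 0).elim (fun hz => (twoRateDensity_of_nonpos hz).ge) fun hz =>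
    (twoRateDensity_pos hz).le

lemma support_twoRateDensity (a : ℝ) : Function.support (twoRateDensity a) = Ioi 0 := by
  ext z
  exact ⟨fun hz => lt_of_not_ge fun h => hz (twoRateDensity_of_nonpos h),
    fun hz => (twoRateDensity_pos hz).ne'⟩

@[fun_prop]
lemma measurable_twoRateDensity (a : ℝ) : Measurable (twoRateDensity a) := by
  unfold twoRateDensity twoRateSurvival
  exact Measurable.ite measurableSet_Iic measurable_const
    ((Measurable.ite measurableSet_Iio measurable_const measurable_const).mul (by fun_prop))

lemma integral_Ioi_twoRateDensity_of_ge (hz : 0 ≤ z) (haz : a ≤ z) :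
    IntegrableOn (twoRateDensity a) (Ioi z) ∧
      ∫ x in Ioi z, twoRateDensity a x = twoRateSurvival a z := by
  have hexp {x : ℝ} (hx : a ≤ x) :
      twoRateSurvival a x = Real.exp (-a / 2) * Real.exp (-1 / 2 * x) := by
    rw [twoRateSurvival, min_eq_right (by linarith), ← Real.exp_add]
    ring_nf
  have heq : EqOn (fun x => 1 / 2 * (Real.exp (-a / 2) * Real.exp (-1 / 2 * x)))
      (twoRateDensity a) (Ioi z) := fun x hx => by
    have hax : a ≤ x := haz.trans (le_of_lt hx)
    dsimp only
    rw [twoRateDensity_of_ge (hz.trans_lt hx) hax, hexp hax]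
  have hneg : (-1 / 2 : ℝ) < 0 := by norm_num
  constructor
  · exact IntegrableOn.congr_fun (((integrableOn_exp_mul_Ioi hneg z).const_mul _).const_mul _) heq
      measurableSet_Ioi
  · rw [← setIntegral_congr_fun measurableSet_Ioi heq, integral_const_mul, integral_const_mul,
      integral_exp_mul_Ioi hneg, hexp haz]
    ring

lemma integral_Ioo_twoRateDensity (hz : 0 ≤ z) (hza : z < a) :
    IntegrableOn (twoRateDensity a) (Ioo z a) ∧
      ∫ x in Ioo z a, twoRateDensity a x = twoRateSurvival a z - twoRateSurvival a a := by
  have hexp {x : ℝ} (hx : x ≤ a) : twoRateSurvival a x = Real.exp (-x) := by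
    rw [twoRateSurvival, min_eq_left (by linarith)]
  have heq : EqOn (fun x => Real.exp (-x)) (twoRateDensity a) (Ioo z a) := fun x hx => by
    rw [twoRateDensity_of_lt (hz.trans_lt hx.1) hx.2, hexp hx.2.le]
  constructor
  · exact ((Continuous.integrableOn_Icc (by fun_prop)).mono_set Ioo_subset_Icc_self).congr_fun heq
      measurableSet_Ioo
  · rw [← setIntegral_congr_fun measurableSet_Ioo heq, ← integral_Ioc_eq_integral_Ioo,
      ← intervalIntegral.integral_of_le hza.le, hexp hza.le, hexp le_rfl]
    simp

lemma integral_Ioi_twoRateDensity (hz : 0 ≤ z) :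
    IntegrableOn (twoRateDensity a) (Ioi z) ∧
      ∫ x in Ioi z, twoRateDensity a x = twoRateSurvival a z := by
  rcases lt_or_ge z a with hza | haz
  · obtain ⟨hint, heq⟩ := integral_Ioo_twoRateDensity hz hza
    obtain ⟨hint', heq'⟩ := integral_Ioi_twoRateDensity_of_ge (hz.trans hza.le) le_rfl (a := a)
    rw [← integrableOn_Ici_iff_integrableOn_Ioi] at hint'
    rw [← Ioo_union_Ici_eq_Ioi hza]
    refine ⟨hint.union hint', ?_⟩
    rw [setIntegral_union (by grind) measurableSet_Ici hint hint', heq,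
      integral_Ici_eq_integral_Ioi, heq', sub_add_cancel]
  · exact integral_Ioi_twoRateDensity_of_ge hz haz

/-- The distribution with hazard rate `1` on `(0, a)` and `1 / 2` on `[a, ∞)`: its virtual valuation
for utility jumps from `1` to `2` at `a`. -/
noncomputable def twoRate (ha : 0 ≤ a) : ValueDist where
  density := twoRateDensity a
  measurable_density := measurable_twoRateDensity a
  density_nonneg := twoRateDensity_nonneg a
  density_of_neg _ hz := twoRateDensity_of_nonpos hz.le
  lintegral_density := by
    obtain ⟨hint, heq⟩ := integral_Ioi_twoRateDensity (a := a) le_rfl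
    rw [integrableOn_iff_integrable_of_support_subset (support_twoRateDensity a).subset] at hint
    rw [← ofReal_integral_eq_lintegral_ofReal hint (.of_forall (twoRateDensity_nonneg a)),
      ← setIntegral_eq_integral_of_forall_compl_eq_zero (s := Ioi 0) fun z hz =>
        twoRateDensity_of_nonpos (not_lt.1 hz), heq, twoRateSurvival_zero ha, ENNReal.ofReal_one]
  ordConnected_support := support_twoRateDensity a ▸ ordConnected_Ioi

lemma cdf_twoRate (ha : 0 ≤ a) (hz : 0 ≤ z) : (twoRate ha).cdf z = 1 - twoRateSurvival a z := by
  rw [← (integral_Ioi_twoRateDensity hz).2, eq_sub_iff_add_eq, ← eq_sub_iff_add_eq']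
  exact ((twoRate ha).one_sub_cdf z).symm

lemma virtual_twoRate_of_lt (ha : 0 ≤ a) (hz : 0 < z) (hza : z < a) :
    (twoRate ha).virtual z = 1 := by
  rw [ValueDist.virtual, cdf_twoRate ha hz.le, sub_sub_cancel]
  exact twoRateDensity_of_lt hz hza ▸ div_self (twoRateDensity_pos hz).ne'

lemma virtual_twoRate_of_ge (ha : 0 ≤ a) (hz : 0 < z) (haz : a ≤ z) :
    (twoRate ha).virtual z = 2 := by
  have hdens : (twoRate ha).density z = 1 / 2 * twoRateSurvival a z := twoRateDensity_of_ge hz haz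
  rw [ValueDist.virtual, cdf_twoRate ha hz.le, sub_sub_cancel, hdens]
  field_simp [twoRateSurvival_pos.ne']

lemma monotoneOn_virtual_twoRate (ha : 0 ≤ a) :
    MonotoneOn (twoRate ha).virtual (Function.support (twoRate ha).density) := by
  have hsupp : Function.support (twoRate ha).density = Ioi 0 := support_twoRateDensity a
  rw [hsupp]
  intro y hy z hz hyz
  rcases lt_or_ge z a with hza | haz
  · rw [virtual_twoRate_of_lt ha hy (hyz.trans_lt hza), virtual_twoRate_of_lt ha hz hza]
  · rw [virtual_twoRate_of_ge ha hz haz]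
    rcases lt_or_ge y a with hya | hay
    · rw [virtual_twoRate_of_lt ha hy hya]
      exact one_le_two
    · rw [virtual_twoRate_of_ge ha hy hay]

lemma ironed_twoRate_eq_of_eventually (ha : 0 ≤ a) {c : ℝ} (hz : 0 ≤ z)
    (hc : ∀ᶠ y in 𝓝[>] z, (twoRate ha).virtual y = c) : (twoRate ha).ironed z = c := by
  refine ValueDist.ironed_eq_of_tendsto_virtual (monotoneOn_virtual_twoRate ha) (fun y hzy => ?_)
    (tendsto_nhds_of_eventually_eq hc)
  rw [cdf_twoRate ha hz, cdf_twoRate ha (hz.trans hzy.le)]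
  exact sub_lt_sub_left (strictAnti_twoRateSurvival a hzy) 1

lemma ironed_twoRate_of_lt (ha : 0 ≤ a) (hz : 0 ≤ z) (hza : z < a) :
    (twoRate ha).ironed z = (1 : ℝ) := by
  refine ironed_twoRate_eq_of_eventually ha hz ?_
  filter_upwards [Ioo_mem_nhdsGT hza] with y hy
  exact virtual_twoRate_of_lt ha (hz.trans_lt hy.1) hy.2

lemma ironed_twoRate_of_ge (ha : 0 ≤ a) (hz : 0 ≤ z) (haz : a ≤ z) :
    (twoRate ha).ironed z = (2 : ℝ) := by
  refine ironed_twoRate_eq_of_eventually ha hz ?_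
  filter_upwards [self_mem_nhdsWithin] with y hy
  exact virtual_twoRate_of_ge ha (hz.trans_lt hy) (haz.trans (le_of_lt hy))

section Opt

variable {n : ℕ} {v : Fin n → ℝ} {i : Fin n} {b : ℝ}

lemma optAlloc_twoRate_tie (ha : 0 ≤ a) (hv : IsProfile v) (h : ∀ j, v j < a) (i : Fin n) :
    (twoRate ha).optAlloc n 1 v i = (n : ℝ)⁻¹ := by
  have hironed : ∀ j, (twoRate ha).ironed (v j) = (1 : ℝ) := fun j =>
    ironed_twoRate_of_lt ha (hv j) (h j)
  exact ValueDist.optAlloc_one_eq_inv_of_forall_eq _ (by simp [hironed]) (by simp [hironed])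

lemma optAlloc_twoRate_winner (ha : 0 ≤ a) (hv : IsProfile v) (hi : a ≤ v i)
    (h : ∀ j, j ≠ i → v j < a) : (twoRate ha).optAlloc n 1 v i = 1 := by
  have hironed : (twoRate ha).ironed (v i) = (2 : ℝ) := ironed_twoRate_of_ge ha (hv i) hi
  refine ValueDist.optAlloc_one_eq_one _ (by simp [hironed]) fun j hj => ?_
  rw [hironed, ironed_twoRate_of_lt ha (hv j) (h j hj), EReal.coe_lt_coe_iff]
  exact one_lt_two

lemma IsProfile.update (hv : IsProfile v) (i : Fin n) {z : ℝ} (hz : 0 ≤ z) :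
    IsProfile (Function.update v i z) := by
  intro j
  rcases eq_or_ne j i with rfl | hj
  · simpa using hz
  · simpa [hj] using hv j

lemma integral_optAlloc_twoRate_of_le (ha : 0 ≤ a) (hv : IsProfile v)
    (h : ∀ j, j ≠ i → v j < a) (hb : 0 ≤ b) (hba : b ≤ a) :
    ∫ z in (0 : ℝ)..b, (twoRate ha).optAlloc n 1 (Function.update v i z) i = b / n := by
  have htie : EqOn (fun z => (twoRate ha).optAlloc n 1 (Function.update v i z) i)
      (fun _ => (n : ℝ)⁻¹) (uIoo 0 b) := fun z hz => by
    rw [uIoo_of_le hb] at hz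
    refine optAlloc_twoRate_tie ha (hv.update i hz.1.le) (fun l => ?_) i
    rcases eq_or_ne l i with rfl | hl
    · simpa using hz.2.trans_le hba
    · simpa [hl] using h l hl
  rw [intervalIntegral.integral_congr_uIoo htie, intervalIntegral.integral_const, smul_eq_mul,
    sub_zero, div_eq_mul_inv]

lemma integral_optAlloc_twoRate_of_ge (ha : 0 ≤ a) (hv : IsProfile v)
    (h : ∀ j, j ≠ i → v j < a) (hab : a ≤ b) :
    ∫ z in a..b, (twoRate ha).optAlloc n 1 (Function.update v i z) i = b - a := by
  have hwin : EqOn (fun z => (twoRate ha).optAlloc n 1 (Function.update v i z) i)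
      (fun _ => 1) (uIoo a b) := fun z hz => by
    rw [uIoo_of_le hab] at hz
    refine optAlloc_twoRate_winner ha (hv.update i (ha.trans hz.1.le)) (by simpa using hz.1.le) ?_
    intro j hj
    simpa [hj] using h j hj
  rw [intervalIntegral.integral_congr_uIoo hwin, intervalIntegral.integral_const, smul_eq_mul,
    mul_one]

lemma optResidual_twoRate_of_lt (ha : 0 ≤ a) (hv : IsProfile v) (h : ∀ j, v j < a) :
    (twoRate ha).optResidual n 1 v = (∑ i, v i) / n := by
  rw [ValueDist.optResidual_eq_sum_integral, Finset.sum_div]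
  exact Finset.sum_congr rfl fun i _ =>
    integral_optAlloc_twoRate_of_le ha hv (fun j _ => h j) (hv i) (h i).le

lemma le_optResidual_twoRate_of_ge (ha : 0 ≤ a) (hv : IsProfile v) (hi : a ≤ v i)
    (h : ∀ j, j ≠ i → v j < a) : a / n + (v i - a) ≤ (twoRate ha).optResidual n 1 v := by
  rw [← integral_optAlloc_twoRate_of_le ha hv h ha le_rfl,
    ← integral_optAlloc_twoRate_of_ge ha hv h hi, intervalIntegral.integral_add_adjacent_intervals
      (ValueDist.intervalIntegrable_optAlloc_one_update _ v i 0 a)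
      (ValueDist.intervalIntegrable_optAlloc_one_update _ v i a (v i)),
    ValueDist.optResidual_eq_sum_integral]
  exact Finset.single_le_sum (f := fun j => ∫ z in (0 : ℝ)..(v j),
      (twoRate ha).optAlloc n 1 (Function.update v j z) j)
    (fun j _ => intervalIntegral.integral_nonneg (hv j) fun _ _ =>
      ValueDist.optAlloc_nonneg _ _ _ _)
    (Finset.mem_univ i)

end Opt

end TwoRate

section Benchmark

lemma benchmark_nonneg {n k : ℕ} {v : Fin n → ℝ} (hv : IsProfile v) : 0 ≤ benchmark n k v :=
  Real.iSup_nonneg fun D => D.optResidual_nonneg k hv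

variable {v : Fin 2 → ℝ} {i j : Fin 2}

lemma optResidual_le_benchmark_two_one (hv : IsProfile v) (D : ValueDist) :
    D.optResidual 2 1 v ≤ benchmark 2 1 v := by
  obtain ⟨i, j, hij, hle⟩ : ∃ i j, i ≠ j ∧ v j ≤ v i :=
    (le_total (v 0) (v 1)).elim (fun h => ⟨1, 0, one_ne_zero, h⟩) fun h => ⟨0, 1, zero_ne_one, h⟩
  exact le_ciSup (f := fun D : ValueDist => D.optResidual 2 1 v)
    ⟨_, forall_mem_range.2 fun D => D.optResidual_two_one_le hv hij hle⟩ D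

lemma half_sum_le_benchmark_two_one (hv : IsProfile v) :
    (∑ i, v i) / 2 ≤ benchmark 2 1 v := by
  have hlt : ∀ i, v i < max (v 0) (v 1) + 1 := Fin.forall_fin_two.2
    ⟨(le_max_left _ _).trans_lt (lt_add_one _), (le_max_right _ _).trans_lt (lt_add_one _)⟩
  exact (optResidual_twoRate_of_lt ((hv 0).trans (hlt 0).le) hv hlt).ge.trans
    (optResidual_le_benchmark_two_one hv _)

lemma sub_half_le_benchmark_two_one (hv : IsProfile v) (hij : i ≠ j) (h : v j < v i) :
    v i - v j / 2 ≤ benchmark 2 1 v := by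
  have hlim : Tendsto (fun a => a / 2 + (v i - a)) (𝓝[>] v j) (𝓝 (v j / 2 + (v i - v j))) :=
    (Continuous.tendsto (by fun_prop) _).mono_left nhdsWithin_le_nhds
  have hbound : ∀ᶠ a in 𝓝[>] v j, a / 2 + (v i - a) ≤ benchmark 2 1 v := by
    filter_upwards [Ioc_mem_nhdsGT h] with a ha
    refine (le_optResidual_twoRate_of_ge ((hv j).trans ha.1.le) hv ha.2 fun l hl => ?_).trans
      (optResidual_le_benchmark_two_one hv _)
    obtain rfl : l = j := by omega
    exact ha.1
  linarith [le_of_tendsto hlim hbound]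

lemma benchmark_two_one_of_le (hv : IsProfile v) (hij : i ≠ j) (h : v j ≤ v i) :
    benchmark 2 1 v = max ((v i + v j) / 2) (v i - v j / 2) := by
  have : Nonempty ValueDist := ⟨twoRate le_rfl⟩
  have hhalf := half_sum_le_benchmark_two_one hv
  rw [sum_fin_two_of_ne hij] at hhalf
  refine le_antisymm (ciSup_le fun D => D.optResidual_two_one_le hv hij h) (max_le hhalf ?_)
  rcases h.lt_or_eq with hlt | heq
  · exact sub_half_le_benchmark_two_one hv hij hlt
  · linarith [hv i]

lemma benchmark_two_one (hv : IsProfile v) : benchmark 2 1 v =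
    max ((v 0 + v 1) / 2) (max (v 0) (v 1) - min (v 0) (v 1) / 2) := by
  rcases le_total (v 0) (v 1) with h | h
  · rw [benchmark_two_one_of_le hv one_ne_zero h, max_eq_right h, min_eq_left h, add_comm]
  · rw [benchmark_two_one_of_le hv zero_ne_one h, max_eq_left h, min_eq_right h]

end Benchmark

section Exponential

variable {r : ℝ}

lemma expMeasure_Ioi (hr : 0 < r) {t : ℝ} (ht : 0 ≤ t) :
    expMeasure r (Ioi t) = ENNReal.ofReal (Real.exp (-(r * t))) := by
  have := isProbabilityMeasure_expMeasure hr
  have hle : Real.exp (-(r * t)) ≤ 1 := Real.exp_le_one_iff.2 (by nlinarith)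
  rw [← compl_Iic, prob_compl_eq_one_sub measurableSet_Iic, ← ofReal_cdf, cdf_expMeasure_eq hr,
    if_pos ht, ← ENNReal.ofReal_one, ← ENNReal.ofReal_sub _ (sub_nonneg.2 hle), sub_sub_cancel]

lemma ae_expMeasure_pos (hr : 0 < r) : ∀ᵐ x ∂expMeasure r, 0 < x := by
  have := isProbabilityMeasure_expMeasure hr
  exact (mem_ae_iff_prob_eq_one measurableSet_Ioi).2 (by simp [expMeasure_Ioi hr le_rfl])

lemma lintegral_expMeasure (hr : 0 < r) {f : ℝ → ENNReal} (hf : Measurable f) :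
    ∫⁻ x, f x ∂expMeasure r =
      ENNReal.ofReal r * ∫⁻ x in Ioi 0, ENNReal.ofReal (Real.exp (-(r * x))) * f x := by
  have hdens : expMeasure r = volume.withDensity (exponentialPDF r) := rfl
  have hpdf : Measurable (exponentialPDF r) := (measurable_exponentialPDFReal r).ennreal_ofReal
  rw [← Measure.restrict_eq_self_of_ae_mem (s := Ioi 0) (ae_expMeasure_pos hr), hdens,
    setLIntegral_withDensity_eq_setLIntegral_mul _ hpdf hf measurableSet_Ioi,
    ← lintegral_const_mul _ (by fun_prop)]
  refine setLIntegral_congr_fun measurableSet_Ioi fun x hx => ?_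
  rw [Pi.mul_apply, exponentialPDF_of_nonneg (le_of_lt hx), ENNReal.ofReal_mul hr.le, mul_assoc]

-- The survival function `exp (-r t)` is the density divided by `r`, so the layer cake formula for
-- the primitive of `g` returns the mean of `g` itself.
lemma mul_lintegral_primitive_expMeasure (hr : 0 < r) {g : ℝ → ℝ} (hg : Measurable g)
    (hg0 : ∀ t, 0 ≤ g t) (hint : ∀ a b, IntervalIntegrable g volume a b) :
    ENNReal.ofReal r * ∫⁻ x, ENNReal.ofReal (∫ t in (0 : ℝ)..x, g t) ∂expMeasure r =
      ∫⁻ x, ENNReal.ofReal (g x) ∂expMeasure r := by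
  rw [lintegral_expMeasure hr hg.ennreal_ofReal, lintegral_comp_eq_lintegral_meas_lt_mul
    (expMeasure r) (f := fun x => x) ((ae_expMeasure_pos hr).mono fun _ => le_of_lt)
    aemeasurable_id (fun _ _ => hint _ _) (.of_forall hg0)]
  congr 1
  exact setLIntegral_congr_fun measurableSet_Ioi fun t ht => by
    rw [← expMeasure_Ioi hr (le_of_lt ht), Ioi]

variable {g : ℝ → ℝ}

lemma ae_primitive_nonneg_expMeasure (hr : 0 < r) (hg0 : ∀ t, 0 ≤ g t) :
    0 ≤ᵐ[expMeasure r] fun x => ∫ t in (0 : ℝ)..x, g t :=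
  (ae_expMeasure_pos hr).mono fun _ hx => intervalIntegral.integral_nonneg hx.le fun t _ => hg0 t

lemma integrable_primitive_expMeasure (hr : 0 < r) (hg : Measurable g) (hg0 : ∀ t, 0 ≤ g t)
    (hint : ∀ a b, IntervalIntegrable g volume a b) (hgi : Integrable g (expMeasure r)) :
    Integrable (fun x => ∫ t in (0 : ℝ)..x, g t) (expMeasure r) := by
  refine (lintegral_ofReal_ne_top_iff_integrable
    (intervalIntegral.continuous_primitive hint 0).aestronglyMeasurable
    (ae_primitive_nonneg_expMeasure hr hg0)).1 ?_
  have hg_top := (lintegral_ofReal_ne_top_iff_integrable hg.aestronglyMeasurable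
    (.of_forall hg0)).2 hgi
  rw [← mul_lintegral_primitive_expMeasure hr hg hg0 hint] at hg_top
  exact fun htop => hg_top (by rw [htop, ENNReal.mul_top (ENNReal.ofReal_pos.2 hr).ne'])

lemma integral_primitive_expMeasure (hr : 0 < r) (hg : Measurable g) (hg0 : ∀ t, 0 ≤ g t)
    (hint : ∀ a b, IntervalIntegrable g volume a b) :
    ∫ x, (∫ t in (0 : ℝ)..x, g t) ∂expMeasure r = (∫ x, g x ∂expMeasure r) / r := by
  rw [eq_div_iff hr.ne', mul_comm, integral_eq_lintegral_of_nonneg_ae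
    (ae_primitive_nonneg_expMeasure hr hg0)
    (intervalIntegral.continuous_primitive hint 0).aestronglyMeasurable,
    integral_eq_lintegral_of_nonneg_ae (.of_forall hg0) hg.aestronglyMeasurable,
    ← mul_lintegral_primitive_expMeasure hr hg hg0 hint, ENNReal.toReal_mul,
    ENNReal.toReal_ofReal hr.le]

lemma integrable_id_expMeasure (hr : 0 < r) : Integrable (fun x => x) (expMeasure r) := by
  have := isProbabilityMeasure_expMeasure hr
  simpa using integrable_primitive_expMeasure hr (measurable_const (a := (1 : ℝ)))
    (fun _ => zero_le_one) (fun _ _ => intervalIntegrable_const) (integrable_const _)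

lemma integral_id_expMeasure (hr : 0 < r) : ∫ x, x ∂expMeasure r = 1 / r := by
  have := isProbabilityMeasure_expMeasure hr
  simpa using integral_primitive_expMeasure hr (measurable_const (a := (1 : ℝ)))
    (fun _ => zero_le_one) (fun _ _ => intervalIntegrable_const)

lemma integral_posPart_sub_expMeasure (hr : 0 < r) {c : ℝ} (hc : 0 ≤ c) :
    ∫ x, max 0 (x - c) ∂expMeasure r = Real.exp (-(r * c)) / r := by
  have hprim : ∀ x, 0 < x → ∫ t in (0 : ℝ)..x, (Ioi c).indicator 1 t = max 0 (x - c) := by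
    intro x hx
    have hset : Ioc 0 x ∩ Ioi c = Ioc c x := by
      rw [← Ioi_inter_Iic, inter_right_comm, Ioi_inter_Ioi, sup_of_le_right hc, Ioi_inter_Iic]
    rw [intervalIntegral.integral_of_le hx.le, setIntegral_indicator measurableSet_Ioi, hset]
    simp [max_comm]
  have hmeas : Measurable ((Ioi c).indicator (1 : ℝ → ℝ)) :=
    measurable_one.indicator measurableSet_Ioi
  rw [← integral_congr_ae ((ae_expMeasure_pos hr).mono hprim), integral_primitive_expMeasure hr
    hmeas (fun _ => indicator_nonneg (fun _ _ => zero_le_one) _) fun a b =>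
      ⟨(integrable_const 1).indicator measurableSet_Ioi,
        (integrable_const 1).indicator measurableSet_Ioi⟩,
    integral_indicator_one measurableSet_Ioi, measureReal_def, expMeasure_Ioi hr hc,
    ENNReal.toReal_ofReal (Real.exp_pos _).le]

lemma integral_exp_neg_mul_expMeasure (hr : 0 < r) {s : ℝ} (hs : 0 < s) :
    ∫ x, Real.exp (-(s * x)) ∂expMeasure r = r / (r + s) := by
  have := isProbabilityMeasure_expMeasure hr
  have hint : Integrable (fun x => Real.exp (-(s * x))) (expMeasure r) :=
    (integrable_const (1 : ℝ)).mono' (by fun_prop) <| (ae_expMeasure_pos hr).mono fun x hx => by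
      rw [Real.norm_eq_abs, Real.abs_exp]
      exact Real.exp_le_one_iff.2 (by nlinarith)
  have hprim : ∀ x, ∫ t in (0 : ℝ)..x, Real.exp (-(s * t)) = (1 - Real.exp (-(s * x))) / s := by
    intro x
    have h := intervalIntegral.integral_comp_mul_left (a := 0) (b := x) Real.exp
      (neg_ne_zero.2 hs.ne')
    simp only [neg_mul] at h
    rw [h, integral_exp]
    simp only [inv_neg, mul_zero, neg_zero, Real.exp_zero, smul_eq_mul, neg_mul]
    field_simp
    ring
  have key := integral_primitive_expMeasure hr (g := fun t => Real.exp (-(s * t))) (by fun_prop)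
    (fun _ => (Real.exp_pos _).le) fun _ _ => (Continuous.intervalIntegrable (by fun_prop) _ _)
  simp_rw [hprim] at key
  rw [integral_div, integral_sub (integrable_const _) hint, integral_const, probReal_univ,
    one_smul] at key
  field_simp at key ⊢
  linarith

end Exponential

section Resampling

variable {ι : Type*} [Fintype ι] [DecidableEq ι] {X : ι → Type*} [∀ j, MeasurableSpace (X j)]
  (μ : ∀ j, Measure (X j)) [∀ j, SigmaFinite (μ j)] (i : ι) [IsProbabilityMeasure (μ i)]

lemma measurePreserving_update :
    MeasurePreserving (fun p : (∀ j, X j) × X i => Function.update p.1 i p.2)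
      ((Measure.pi μ).prod (μ i)) (Measure.pi μ) := by
  refine ⟨measurable_update', (Measure.pi_eq fun s hs => ?_).symm⟩
  have hpre : (fun p : (∀ j, X j) × X i => Function.update p.1 i p.2) ⁻¹' univ.pi s =
      univ.pi (Function.update s i univ) ×ˢ s i := by
    ext p
    simp only [mem_preimage, mem_univ_pi, mem_prod, Function.forall_update_iff,
      Function.forall_update_iff s fun j t => p.1 j ∈ t, mem_univ, true_and]
    exact and_comm
  rw [Measure.map_apply measurable_update' (.univ_pi hs), hpre, Measure.prod_prod, Measure.pi_pi,
    ← Finset.prod_erase_mul _ _ (Finset.mem_univ i), Function.update_self, measure_univ, mul_one,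
    ← Finset.prod_erase_mul _ (fun j => μ j (s j)) (Finset.mem_univ i)]
  congr 1
  exact Finset.prod_congr rfl fun j hj => by rw [Function.update_of_ne (Finset.ne_of_mem_erase hj)]

variable {μ} {E : Type*} [NormedAddCommGroup E] [NormedSpace ℝ E] {g : (∀ j, X j) → E}

lemma integrable_integral_update (hg : Integrable g (Measure.pi μ)) :
    Integrable (fun t => ∫ v, g (Function.update v i t) ∂Measure.pi μ) (μ i) :=
  ((measurePreserving_update μ i).integrable_comp_of_integrable hg).integral_prod_right

lemma integral_integral_update (hg : Integrable g (Measure.pi μ)) :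
    ∫ t, (∫ v, g (Function.update v i t) ∂Measure.pi μ) ∂μ i = ∫ v, g v ∂Measure.pi μ := by
  have hmp := measurePreserving_update μ i
  have hg' := hmp.map_eq.symm ▸ hg.aestronglyMeasurable
  calc ∫ t, (∫ v, g (Function.update v i t) ∂Measure.pi μ) ∂μ i
      = ∫ p, g (Function.update p.1 i p.2) ∂(Measure.pi μ).prod (μ i) :=
        (integral_prod_symm _ (hmp.integrable_comp_of_integrable hg)).symm
    _ = ∫ v, g v ∂(((Measure.pi μ).prod (μ i)).map fun p => Function.update p.1 i p.2) :=
        (integral_map hmp.aemeasurable hg').symm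
    _ = ∫ v, g v ∂Measure.pi μ := by rw [hmp.map_eq]

end Resampling

section IIDExponential

/-- The law of `n` independent exponential valuations of rate `r`, so that `expPrior` is
`iidExp 2 1`. -/
noncomputable abbrev iidExp (n : ℕ) (r : ℝ) : Measure (Fin n → ℝ) :=
  Measure.pi fun _ => expMeasure r

variable {n : ℕ} {r : ℝ}

lemma ae_isProfile_iidExp (hr : 0 < r) : ∀ᵐ v ∂iidExp n r, IsProfile v := by
  have := isProbabilityMeasure_expMeasure hr
  exact ae_all_iff.2 fun i => Measure.tendsto_eval_ae_ae.eventually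
    ((ae_expMeasure_pos hr).mono fun _ => le_of_lt)

lemma integrable_eval_iidExp (hr : 0 < r) (i : Fin n) :
    Integrable (fun v : Fin n → ℝ => v i) (iidExp n r) := by
  have := isProbabilityMeasure_expMeasure hr
  exact integrable_eval (integrable_id_expMeasure hr)

lemma integral_eval_iidExp (hr : 0 < r) (i : Fin n) : ∫ v, v i ∂iidExp n r = 1 / r := by
  have := isProbabilityMeasure_expMeasure hr
  exact (integral_comp_eval (μ := fun _ : Fin n => expMeasure r) (f := fun x : ℝ => x)
    aestronglyMeasurable_id).trans (integral_id_expMeasure hr)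

lemma integrable_posPart_iidExp (hr : 0 < r) (i j : Fin n) :
    Integrable (fun v : Fin n → ℝ => max 0 (v i / 2 - v j)) (iidExp n r) :=
  (integrable_zero _ _ _).sup
    (((integrable_eval_iidExp hr i).div_const 2).sub (integrable_eval_iidExp hr j))

lemma integral_posPart_iidExp (hr : 0 < r) {i j : Fin n} (hij : i ≠ j) :
    ∫ v, max 0 (v i / 2 - v j) ∂iidExp n r = 1 / (6 * r) := by
  have := isProbabilityMeasure_expMeasure hr
  have hcond : ∀ t, 0 < t → ∫ v, max 0 (Function.update v j t i / 2 - Function.update v j t j)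
      ∂iidExp n r = Real.exp (-(2 * r * t)) / (2 * r) := by
    intro t ht
    have hscale : ∀ x : ℝ, max 0 (x / 2 - t) = max 0 (x - 2 * t) / 2 := fun x => by
      rw [← max_div_div_right zero_le_two]
      ring_nf
    simp only [Function.update_self, Function.update_of_ne hij, hscale]
    rw [integral_comp_eval (μ := fun _ : Fin n => expMeasure r) (i := i)
      (f := fun x : ℝ => max 0 (x - 2 * t) / 2) (by fun_prop), integral_div,
      integral_posPart_sub_expMeasure hr (by positivity)]
    ring_nf
  rw [← integral_integral_update j (integrable_posPart_iidExp hr i j),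
    integral_congr_ae ((ae_expMeasure_pos hr).mono hcond), integral_div,
    integral_exp_neg_mul_expMeasure hr (by positivity)]
  field_simp
  norm_num

lemma benchmark_two_one_eq_add_posPart {v : Fin 2 → ℝ} (hv : IsProfile v) : benchmark 2 1 v =
    (v 0 + v 1) / 2 + max 0 (v 0 / 2 - v 1) + max 0 (v 1 / 2 - v 0) := by
  have h0 := hv 0
  have h1 := hv 1
  rw [benchmark_two_one hv]
  grind

lemma integrable_benchmark_two_one (hr : 0 < r) : Integrable (benchmark 2 1) (iidExp 2 r) :=
  (((((integrable_eval_iidExp hr 0).add (integrable_eval_iidExp hr 1)).div_const 2).add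
    (integrable_posPart_iidExp hr 0 1)).add (integrable_posPart_iidExp hr 1 0)).congr <|
      (ae_isProfile_iidExp hr).mono fun _ hv => (benchmark_two_one_eq_add_posPart hv).symm

lemma integral_benchmark_two_one (hr : 0 < r) :
    ∫ v, benchmark 2 1 v ∂iidExp 2 r = 4 / (3 * r) := by
  have hmean : Integrable (fun v : Fin 2 → ℝ => (v 0 + v 1) / 2) (iidExp 2 r) :=
    ((integrable_eval_iidExp hr 0).add (integrable_eval_iidExp hr 1)).div_const 2
  have hpos := integrable_posPart_iidExp hr (0 : Fin 2) 1
  have hadd : Integrable (fun v : Fin 2 → ℝ => (v 0 + v 1) / 2 + max 0 (v 0 / 2 - v 1))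
      (iidExp 2 r) := hmean.add hpos
  rw [integral_congr_ae ((ae_isProfile_iidExp hr).mono fun _ => benchmark_two_one_eq_add_posPart),
    integral_add hadd (integrable_posPart_iidExp hr 1 0),
    integral_add hmean hpos, integral_div,
    integral_add (integrable_eval_iidExp hr 0) (integrable_eval_iidExp hr 1),
    integral_eval_iidExp hr, integral_eval_iidExp hr, integral_posPart_iidExp hr zero_ne_one,
    integral_posPart_iidExp hr one_ne_zero]
  field_simp
  norm_num

end IIDExponential

section Envelope

variable {X P Φ : ℝ → ℝ} {a b : ℝ}

lemma le_of_forall_sub_le_mul_sub (hab : a ≤ b)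
    (h : ∀ s ∈ Icc a b, ∀ t ∈ Icc a b, s ≤ t → Φ t - Φ s ≤ (t - s) * (X t - X s)) : Φ b ≤ Φ a := by
  have hgrid : ∀ N : ℕ, Φ b ≤ Φ a + 1 / ((N : ℝ) + 1) * ((b - a) * (X b - X a)) := by
    intro N
    set δ := (b - a) / ((N : ℝ) + 1) with hδ
    have : 0 ≤ δ := div_nonneg (sub_nonneg.2 hab) (by positivity)
    have hend : a + ((N : ℝ) + 1) * δ = b := by rw [hδ]; field_simp; ring
    have hmem : ∀ j : ℕ, j ≤ N + 1 → a + j * δ ∈ Icc a b := fun j hj => by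
      have hj' : (j : ℝ) ≤ N + 1 := by exact_mod_cast hj
      exact ⟨le_add_of_nonneg_right (by positivity), hend ▸ by gcongr⟩
    have htel : ∀ j : ℕ, j ≤ N + 1 →
        Φ (a + j * δ) ≤ Φ a + δ * (X (a + j * δ) - X a) := by
      intro j hj
      induction j with
      | zero => simp
      | succ j ih =>
        have hinc := h _ (hmem j (by omega)) _ (hmem (j + 1) hj) (by gcongr; simp)
        have hgap : a + ((j + 1 : ℕ) : ℝ) * δ - (a + j * δ) = δ := by push_cast; ring
        rw [hgap] at hinc
        linarith [ih (by omega)]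
    have := htel (N + 1) le_rfl
    rw [Nat.cast_succ, hend] at this
    convert this using 2
    rw [hδ]
    ring
  have hlim := (tendsto_one_div_add_atTop_nhds_zero_nat (𝕜 := ℝ)).mul_const
    ((b - a) * (X b - X a)) |>.const_add (Φ a)
  simpa using ge_of_tendsto' hlim hgrid

lemma monotoneOn_of_incentiveCompatible {s : Set ℝ}
    (hic : ∀ t ∈ s, ∀ c ∈ s, t * X c - P c ≤ t * X t - P t) : MonotoneOn X s := by
  intro t ht c hc htc
  rcases htc.eq_or_lt with rfl | hlt
  · rfl
  · have h : 0 ≤ (c - t) * (X c - X t) := by linarith [hic t ht c hc, hic c hc t ht]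
    exact sub_nonneg.1 (nonneg_of_mul_nonneg_right h (sub_pos.2 hlt))

lemma utility_le_add_integral_of_incentiveCompatible (hab : a ≤ b)
    (hic : ∀ t ∈ Icc a b, ∀ c ∈ Icc a b, t * X c - P c ≤ t * X t - P t) :
    b * X b - P b ≤ a * X a - P a + ∫ s in a..b, X s := by
  have hmono := monotoneOn_of_incentiveCompatible hic
  have hint : ∀ t ∈ Icc a b, ∀ c ∈ Icc a b, IntervalIntegrable X volume t c := fun t ht c hc =>
    (hmono.mono (ordConnected_Icc.uIcc_subset ht hc)).intervalIntegrable
  have hle := le_of_forall_sub_le_mul_sub (X := X)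
    (Φ := fun t => t * X t - P t - ∫ s in a..t, X s) hab fun s hs t ht hst => by
      have ha := left_mem_Icc.2 hab
      have hsplit := intervalIntegral.integral_interval_sub_left (hint a ha t ht) (hint a ha s hs)
      have hlow : ∫ _ in s..t, X s ≤ ∫ z in s..t, X z :=
        intervalIntegral.integral_mono_on hst intervalIntegrable_const (hint s hs t ht)
          fun z hz => hmono hs ⟨hs.1.trans hz.1, hz.2.trans ht.2⟩ hz.1
      rw [intervalIntegral.integral_const, smul_eq_mul] at hlow
      linarith [hic s hs t ht]
  simp only [intervalIntegral.integral_same] at hle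
  linarith

end Envelope

namespace Mechanism

variable {n k : ℕ} {M : Mechanism n k} {i : Fin n} {μ : Measure (Fin n → ℝ)}

lemma pay_le_sum_sub_residual (v : Fin n → ℝ) :
    M.pay v i ≤ ∑ j, v j * M.alloc v j - M.residual v := by
  rw [residual, Finset.sum_sub_distrib, sub_sub_cancel]
  exact Finset.single_le_sum (f := M.pay v) (fun j _ => M.pay_nonneg v j) (Finset.mem_univ i)

lemma sum_alloc_le_min (v : Fin n → ℝ) : ∑ i, M.alloc v i ≤ (min n k : ℕ) := by
  rw [Nat.cast_min]
  refine le_min ?_ (M.sum_alloc_le v)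
  simpa using Finset.sum_le_card_nsmul Finset.univ _ 1 fun i _ => M.alloc_le_one v i

lemma norm_alloc_le_one (v : Fin n → ℝ) : ‖M.alloc v i‖ ≤ 1 := by
  rw [Real.norm_eq_abs, abs_of_nonneg (M.alloc_nonneg v i)]
  exact M.alloc_le_one v i

lemma measurable_interimAlloc [SFinite μ] : Measurable (M.interimAlloc μ i) :=
  ((M.measurable_alloc i).comp
    measurable_update').stronglyMeasurable.integral_prod_left'.measurable

lemma integrable_alloc_comp [IsFiniteMeasure μ] {f : (Fin n → ℝ) → Fin n → ℝ} (hf : Measurable f) :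
    Integrable (fun v => M.alloc (f v) i) μ :=
  .of_bound ((M.measurable_alloc i).comp hf).aestronglyMeasurable 1 <|
    .of_forall fun _ => norm_alloc_le_one _

lemma integrable_value_mul_alloc (hi : Integrable (fun v => v i) μ) :
    Integrable (fun v => v i * M.alloc v i) μ :=
  hi.mul_bdd (M.measurable_alloc i).aestronglyMeasurable (.of_forall norm_alloc_le_one)

lemma integrable_pay_of_integrable_residual (hμ : ∀ j, Integrable (fun v => v j) μ)
    (hres : Integrable M.residual μ) : Integrable (fun v => M.pay v i) μ :=
  ((integrable_finsetSum _ fun j _ => integrable_value_mul_alloc (hμ j)).sub hres).mono'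
    (M.measurable_pay i).aestronglyMeasurable <| .of_forall fun v => by
      rw [Real.norm_eq_abs, abs_of_nonneg (M.pay_nonneg v i)]
      exact pay_le_sum_sub_residual v

lemma integrable_pay_comp (hres : ∀ v, IsProfile v → 0 ≤ M.residual v)
    {f : (Fin n → ℝ) → Fin n → ℝ} (hf : Measurable f) (hprof : ∀ᵐ v ∂μ, IsProfile (f v))
    (hint : ∀ j, Integrable (fun v => f v j) μ) : Integrable (fun v => M.pay (f v) i) μ := by
  refine (integrable_finsetSum Finset.univ fun j _ => hint j).mono'
    ((M.measurable_pay i).comp hf).aestronglyMeasurable ?_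
  filter_upwards [hprof] with v hv
  rw [Real.norm_eq_abs, abs_of_nonneg (M.pay_nonneg _ i)]
  calc M.pay (f v) i
      ≤ ∑ j, f v j * M.alloc (f v) j - M.residual (f v) := pay_le_sum_sub_residual _
    _ ≤ ∑ j, f v j * M.alloc (f v) j := sub_le_self _ (hres _ hv)
    _ ≤ ∑ j, f v j := Finset.sum_le_sum fun j _ =>
        mul_le_of_le_one_right (hv j) (M.alloc_le_one _ j)

lemma integral_utility_update [IsFiniteMeasure μ] {b : ℝ}
    (hpay : Integrable (fun v => M.pay (Function.update v i b) i) μ) (t : ℝ) :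
    ∫ v, (t * M.alloc (Function.update v i b) i - M.pay (Function.update v i b) i) ∂μ =
      t * M.interimAlloc μ i b - M.interimPay μ i b := by
  rw [integral_sub ((integrable_alloc_comp measurable_update_left).const_mul t) hpay,
    integral_const_mul, interimAlloc, interimPay]

/-- Bayesian incentive compatibility with finite interim payments: the notion `IsBayesian` without
ex interim individual rationality. -/
def IsBIC (M : Mechanism n k) (μ : Measure (Fin n → ℝ)) : Prop :=
  (∀ i, ∀ b : ℝ, 0 ≤ b → Integrable (fun v => M.pay (Function.update v i b) i) μ) ∧
  ∀ i, ∀ t b : ℝ, 0 ≤ t → 0 ≤ b →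
    t * M.interimAlloc μ i b - M.interimPay μ i b ≤ t * M.interimAlloc μ i t - M.interimPay μ i t

lemma IsBayesian.isBIC (hM : M.IsBayesian μ) : M.IsBIC μ := ⟨hM.1, hM.2.1⟩

lemma IsTruthful.isBIC [IsFiniteMeasure μ] (hM : M.IsTruthful)
    (hres : ∀ v, IsProfile v → 0 ≤ M.residual v) (hprof : ∀ᵐ v ∂μ, IsProfile v)
    (hμ : ∀ j, Integrable (fun v => v j) μ) : M.IsBIC μ := by
  have hpay : ∀ i, ∀ b : ℝ, 0 ≤ b →
      Integrable (fun v => M.pay (Function.update v i b) i) μ := fun i b hb =>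
    integrable_pay_comp hres measurable_update_left (hprof.mono fun _ hv => hv.update i hb)
      fun j => by
        rcases eq_or_ne j i with rfl | hj
        · simp only [Function.update_self, integrable_const]
        · simpa only [Function.update_of_ne hj] using hμ j
  refine ⟨hpay, fun i t b ht hb => ?_⟩
  rw [← integral_utility_update (hpay i b hb), ← integral_utility_update (hpay i t ht)]
  have halloc : ∀ c, Integrable (fun v => t * M.alloc (Function.update v i c) i) μ :=
    fun c => (integrable_alloc_comp measurable_update_left).const_mul t
  refine integral_mono_ae ((halloc b).sub (hpay i b hb)) ((halloc t).sub (hpay i t ht)) ?_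
  filter_upwards [hprof] with v hv
  simpa only [Function.update_self, Function.update_idem] using hM _ (hv.update i ht) i b hb

lemma IsBIC.interimUtility_le_integral (hM : M.IsBIC μ) {t : ℝ} (ht : 0 ≤ t) :
    t * M.interimAlloc μ i t - M.interimPay μ i t ≤ ∫ s in (0 : ℝ)..t, M.interimAlloc μ i s := by
  have hpay : 0 ≤ M.interimPay μ i 0 := integral_nonneg fun v => M.pay_nonneg _ i
  linarith [utility_le_add_integral_of_incentiveCompatible ht fun s hs c hc =>
    hM.2 i s c hs.1 hc.1]

section Exponential

variable {r : ℝ}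

lemma integral_primitive_interimAlloc (hr : 0 < r) :
    Integrable (fun t => ∫ s in (0 : ℝ)..t, M.interimAlloc (iidExp n r) i s) (expMeasure r) ∧
      ∫ t, (∫ s in (0 : ℝ)..t, M.interimAlloc (iidExp n r) i s) ∂expMeasure r =
        (∫ v, M.alloc v i ∂iidExp n r) / r := by
  have := isProbabilityMeasure_expMeasure hr
  have hnonneg : ∀ t, 0 ≤ M.interimAlloc (iidExp n r) i t :=
    fun t => integral_nonneg fun v => M.alloc_nonneg _ i
  have hnorm : ∀ t, ‖M.interimAlloc (iidExp n r) i t‖ ≤ 1 := fun t => by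
    simpa [interimAlloc] using norm_integral_le_of_norm_le_const (μ := iidExp n r)
      (.of_forall fun v => M.norm_alloc_le_one (i := i) (Function.update v i t))
  have hint : ∀ a b, IntervalIntegrable (M.interimAlloc (iidExp n r) i) volume a b := fun a b =>
    (intervalIntegrable_const (c := (1 : ℝ))).mono_fun
      M.measurable_interimAlloc.aestronglyMeasurable (.of_forall fun t => by simpa using hnorm t)
  have halloc : Integrable (fun v => M.alloc v i) (iidExp n r) :=
    integrable_alloc_comp measurable_id
  rw [← integral_integral_update i halloc]
  exact ⟨integrable_primitive_expMeasure hr M.measurable_interimAlloc hnonneg hint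
      (integrable_integral_update i halloc),
    integral_primitive_expMeasure hr M.measurable_interimAlloc hnonneg hint⟩

lemma IsBIC.integral_utility_le (hM : M.IsBIC (iidExp n r)) (hr : 0 < r)
    (hpay : Integrable (fun v => M.pay v i) (iidExp n r)) :
    ∫ v, (v i * M.alloc v i - M.pay v i) ∂iidExp n r ≤ (∫ v, M.alloc v i ∂iidExp n r) / r := by
  have := isProbabilityMeasure_expMeasure hr
  have hutil : Integrable (fun v => v i * M.alloc v i - M.pay v i) (iidExp n r) :=
    (integrable_value_mul_alloc (integrable_eval_iidExp hr i)).sub hpay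
  obtain ⟨hint, heq⟩ := M.integral_primitive_interimAlloc (i := i) hr
  rw [← integral_integral_update i hutil, ← heq]
  refine integral_mono_ae (integrable_integral_update i hutil) hint ?_
  filter_upwards [ae_expMeasure_pos hr] with t ht
  simp only [Function.update_self]
  rw [integral_utility_update (hM.1 i t ht.le)]
  exact hM.interimUtility_le_integral ht.le

lemma IsBIC.integral_residual_le (hM : M.IsBIC (iidExp n r)) (hr : 0 < r) :
    ∫ v, M.residual v ∂iidExp n r ≤ (min n k : ℕ) / r := by
  have := isProbabilityMeasure_expMeasure hr
  by_cases hres : Integrable M.residual (iidExp n r)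
  swap
  · rw [integral_undef hres]
    positivity
  have hpay : ∀ i, Integrable (fun v => M.pay v i) (iidExp n r) := fun i =>
    integrable_pay_of_integrable_residual (integrable_eval_iidExp hr) hres
  have halloc : ∀ i ∈ Finset.univ, Integrable (fun v => M.alloc v i) (iidExp n r) :=
    fun i _ => integrable_alloc_comp measurable_id
  calc ∫ v, M.residual v ∂iidExp n r
      = ∑ i, ∫ v, (v i * M.alloc v i - M.pay v i) ∂iidExp n r :=
        integral_finsetSum _ fun i _ =>
          (integrable_value_mul_alloc (integrable_eval_iidExp hr i)).sub (hpay i)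
    _ ≤ ∑ i, (∫ v, M.alloc v i ∂iidExp n r) / r :=
        Finset.sum_le_sum fun i _ => hM.integral_utility_le hr (hpay i)
    _ = (∫ v, ∑ i, M.alloc v i ∂iidExp n r) / r := by
        rw [← Finset.sum_div, integral_finsetSum _ halloc]
    _ ≤ (∫ _, ((min n k : ℕ) : ℝ) ∂iidExp n r) / r := by
        gcongr
        exacts [integrable_finsetSum _ halloc, integrable_const _, M.sum_alloc_le_min]
    _ = (min n k : ℕ) / r := by rw [integral_const, probReal_univ, one_smul]

end Exponential

section Lottery

/-- The lottery that serves every agent with the same probability `min n k / n`, ignoring the bids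
and without payments. -/
noncomputable def uniformLottery (n k : ℕ) : Mechanism n k where
  alloc _ _ := (min n k : ℕ) / n
  pay _ _ := 0
  measurable_alloc _ := measurable_const
  measurable_pay _ := measurable_const
  alloc_nonneg _ _ := by positivity
  alloc_le_one _ _ := div_le_one_of_le₀ (by exact_mod_cast min_le_left n k) (by positivity)
  sum_alloc_le _ := by
    rcases n.eq_zero_or_pos with rfl | hn
    · simp
    · rw [Finset.sum_const, Finset.card_univ, Fintype.card_fin, nsmul_eq_mul,
        mul_div_cancel₀ _ (by positivity)]
      exact_mod_cast min_le_right n k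
  pay_nonneg _ _ := le_rfl

lemma isBayesian_uniformLottery : (uniformLottery n k).IsBayesian μ := by
  refine ⟨fun _ _ _ => integrable_zero _ _ _, fun _ _ _ _ _ => le_rfl, fun i t ht => ?_⟩
  have hnonneg : 0 ≤ (uniformLottery n k).interimAlloc μ i t :=
    integral_nonneg fun _ => (uniformLottery n k).alloc_nonneg _ _
  have hpay : (uniformLottery n k).interimPay μ i t = 0 := integral_zero _ _
  rw [hpay, sub_zero]
  positivity

lemma integral_residual_uniformLottery {r : ℝ} (hr : 0 < r) :
    ∫ v, (uniformLottery n k).residual v ∂iidExp n r = (min n k : ℕ) / r := by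
  simp only [residual, uniformLottery, sub_zero, ← Finset.sum_mul]
  rw [integral_mul_const, integral_finsetSum _ fun i _ => integrable_eval_iidExp hr i]
  simp only [integral_eval_iidExp hr, Finset.sum_const, Finset.card_univ, Fintype.card_fin,
    nsmul_eq_mul]
  rcases n.eq_zero_or_pos with rfl | hn
  · simp
  · field_simp

end Lottery

lemma Approximates.residual_nonneg {β : ℝ} (hM : M.Approximates β) {v : Fin n → ℝ}
    (hv : IsProfile v) : 0 ≤ M.residual v :=
  (div_nonneg (benchmark_nonneg hv) hM.1.le).trans (hM.2 v hv)

lemma integrable_residual {r : ℝ} (hr : 0 < r) (hres : ∀ v, IsProfile v → 0 ≤ M.residual v) :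
    Integrable M.residual (iidExp n r) :=
  integrable_finsetSum _ fun i _ =>
    (integrable_value_mul_alloc (integrable_eval_iidExp hr i)).sub
      (integrable_pay_comp hres measurable_id (ae_isProfile_iidExp hr) (integrable_eval_iidExp hr))

theorem IsTruthful.four_thirds_le {M : Mechanism 2 1} {β : ℝ} (hM : M.IsTruthful)
    (hβ : M.Approximates β) : 4 / 3 ≤ β := by
  have := isProbabilityMeasure_expMeasure one_pos
  have hres : ∀ v, IsProfile v → 0 ≤ M.residual v := fun _ => hβ.residual_nonneg
  have hbic : M.IsBIC (iidExp 2 1) :=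
    hM.isBIC hres (ae_isProfile_iidExp one_pos) (integrable_eval_iidExp one_pos)
  have hle : ∫ v, benchmark 2 1 v / β ∂iidExp 2 1 ≤ ∫ v, M.residual v ∂iidExp 2 1 :=
    integral_mono_ae ((integrable_benchmark_two_one one_pos).div_const β)
      (integrable_residual one_pos hres) ((ae_isProfile_iidExp one_pos).mono hβ.2)
  have hbound := hle.trans (hbic.integral_residual_le one_pos)
  rw [integral_div, integral_benchmark_two_one one_pos] at hbound
  norm_num at hbound
  exact (div_le_one hβ.1).1 hbound

end Mechanism

end MoneyBurning

open MoneyBurning MeasureTheory in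
theorem mainTheorem7_general :
    (∀ (M : Mechanism 2 1) (β : ℝ), M.IsTruthful → M.Approximates β → 4 / 3 ≤ β) ∧
    (∀ (n k : ℕ) (r : ℝ), 0 < r →
      (∀ M : Mechanism n k, M.IsBIC (iidExp n r) →
        ∫ v, M.residual v ∂iidExp n r ≤ (min n k : ℕ) / r) ∧
      ∃ M : Mechanism n k, M.IsBayesian (iidExp n r) ∧
        ∫ v, M.residual v ∂iidExp n r = (min n k : ℕ) / r) ∧
    (∀ v : Fin 2 → ℝ, IsProfile v →
      benchmark 2 1 v = max ((v 0 + v 1) / 2) (max (v 0) (v 1) - min (v 0) (v 1) / 2)) ∧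
    (∀ r : ℝ, 0 < r → Integrable (benchmark 2 1) (iidExp 2 r) ∧
      ∫ v, benchmark 2 1 v ∂iidExp 2 r = 4 / (3 * r)) :=
  ⟨fun _ _ hM hβ => hM.four_thirds_le hβ,
    fun n k _ hr => ⟨fun _ hM => hM.integral_residual_le hr, Mechanism.uniformLottery n k,
      Mechanism.isBayesian_uniformLottery, Mechanism.integral_residual_uniformLottery hr⟩,
    fun _ hv => benchmark_two_one hv,
    fun _ hr => ⟨integrable_benchmark_two_one hr, integral_benchmark_two_one hr⟩⟩

open MoneyBurning MeasureTheory in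
theorem mainTheorem7 :
    -- no prior-free mechanism for two agents and one unit beats the factor `4/3`
    (∀ (M : Mechanism 2 1) (β : ℝ), M.IsPriorFree → M.Approximates β → 4 / 3 ≤ β) ∧
    -- the optimal expected residual surplus for two i.i.d. standard exponential valuations is `1`
    IsGreatest {r : ℝ | ∃ M : Mechanism 2 1, M.IsBayesian expPrior ∧
      r = ∫ v, M.residual v ∂expPrior} 1 ∧
    -- the benchmark on a profile with larger value `max` and smaller value `min`
    (∀ v : Fin 2 → ℝ, IsProfile v →
      benchmark 2 1 v = max ((v 0 + v 1) / 2) (max (v 0) (v 1) - min (v 0) (v 1) / 2)) ∧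
    -- the expected benchmark for two i.i.d. standard exponential valuations is `4/3`
    (Integrable (benchmark 2 1) expPrior ∧ ∫ v, benchmark 2 1 v ∂expPrior = 4 / 3) := by
  obtain ⟨hlower, hoptimal, hformula, hmean⟩ := mainTheorem7_general
  have hprior : expPrior = iidExp 2 1 := rfl
  obtain ⟨hle, M, hM, hres⟩ := hoptimal 2 1 1 one_pos
  refine ⟨fun M β hM hβ => hlower M β hM.1 hβ, ⟨⟨M, hM, ?_⟩, ?_⟩, hformula, ?_⟩
  · simpa [hprior] using hres.symm
  · rintro _ ⟨M, hM, rfl⟩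
    simpa [hprior] using hle M hM.isBIC
  · simpa [hprior] using hmean 1 one_pos
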